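/- Let $M$ be a compact smooth surface (without boundary) with a smooth Riemannian metric. Let $l,h>0$ and suppose that $M$ contains an embedded flat cylinder $C$ isometric (in the Riemannian sense, up to the boundary) to the Euclidean cylinder $[0,l]\times\mathbb{R}/(2\pi h\mathbb{Z})$. Let $(g_t)_{t\in\mathbb{R}}$ be the geodesic flow on the unit tangent bundle $T^1M$, and let $\mu$ be a Borel probability measure on $T^1M$ that is invariant and ergodic for $(g_t)$ and has full support, i.e. gives positive mass to every nonempty open subset of $T^1M$. Let $\gamma$ be a unit-speed closed geodesic of period $T>0$ contained in the interior of $C$, let $\delta=\frac1T\int_0^T\delta_{\gamma'(t)}\,dt$ be the invariant probability measure (the "Dirac measure") carried by the closed orbit $\gamma'$ in $T^1M$, and let $d$ be the Riemannian distance in $M$ between $\gamma$ and the boundary of $C$. Equip $T^1M$ with the distance $d_{T^1M}$ of the Riemannian metric induced on it, as a submanifold of $TM$, by the Sasaki metric: the metric of $TM$ for which the projection $TM\to M$ is a Riemannian submersion, the fibres carry their Euclidean metric, and the horizontal and vertical distributions of the Levi-Civita connection are orthogonal. Define the Prohorov distance of Borel probability measures on $T^1M$ by $$\rho(\nu,\nu')=\inf\{\varepsilon>0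 : \nu(A)\le\nu'(V_\varepsilon(A))+\varepsilon\ \text{for every Borel set } A\subset T^1M\},$$ where $V_\varepsilon(A)=\{y\in T^1M : d_{T^1M}(x,y)<\varepsilon \text{ for some } x\in A\}$. Then $$\rho(\delta,\mu)\ \ge\ \min\Bigl(d,\ \frac{l}{l+2}\Bigr).$$ -/

import Mathlib

open Manifold Bundle MeasureTheory Set
open scoped ContDiff ENNReal Topology

noncomputable section

/-- The Euclidean plane, on which surfaces are modelled. -/
abbrev Plane : Type := EuclideanSpace ℝ (Fin 2)

section Surface

variable {M : Type*} [TopologicalSpace M] [ChartedSpace Plane M] [IsManifold (𝓡 2) ∞ M]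

/-- The velocity `γ'(t)` of a curve in a surface. -/
def velocity (γ : ℝ → M) (t : ℝ) : TangentSpace (𝓡 2) (γ t) :=
  mfderiv 𝓘(ℝ, ℝ) (𝓡 2) γ t (1 : ℝ)

/-- The coordinate vector field `∂_i` of the preferred chart at `p`, evaluated at `q`
(meaningful for `q` in the domain of that chart). -/
def coordVec (p q : M) (i : Fin 2) : TangentSpace (𝓡 2) q :=
  (trivializationAt Plane (TangentSpace (𝓡 2)) p).symmL ℝ q (EuclideanSpace.single i 1)

/-- The `i`-th component of the tangent vector `v` at `q` in the frame `∂_0, ∂_1` of the preferred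
chart at `p` (meaningful for `q` in the domain of that chart). -/
def coordComp (p q : M) (v : TangentSpace (𝓡 2) q) (i : Fin 2) : ℝ :=
  ((trivializationAt Plane (TangentSpace (𝓡 2)) p).continuousLinearMapAt ℝ q v : Plane) i

variable [RiemannianBundle (fun x : M ↦ TangentSpace (𝓡 2) x)]

/-- The matrix `g_{ij} = ⟨∂_i, ∂_j⟩` of the metric in the preferred chart at `p`, as a function
of the coordinates `y`. -/
def metricMatrix (p : M) (y : Plane) : Matrix (Fin 2) (Fin 2) ℝ :=
  Matrix.of fun i j ↦
    inner ℝ (coordVec p ((extChartAt (𝓡 2) p).symm y) i)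
      (coordVec p ((extChartAt (𝓡 2) p).symm y) j)

/-- The partial derivative `∂_k g_{ij}` in the preferred chart at `p`. -/
def metricDeriv (p : M) (y : Plane) (k i j : Fin 2) : ℝ :=
  fderiv ℝ (fun z : Plane ↦ metricMatrix p z i j) y (EuclideanSpace.single k 1)

/-- The Christoffel symbols `Γ^k_{ij} = ½ ∑_m g^{km} (∂_i g_{jm} + ∂_j g_{im} - ∂_m g_{ij})` of the
Levi-Civita connection, in the preferred chart at `p`. -/
def christoffel (p : M) (y : Plane) (k i j : Fin 2) : ℝ :=
  (1 / 2 : ℝ) * ∑ m, (metricMatrix p y)⁻¹ k m *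
    (metricDeriv p y i j m + metricDeriv p y j i m - metricDeriv p y m i j)

/-- The covariant derivative `DV/dt` at time `t`, for the Levi-Civita connection, of a vector
field `V` along a curve `γ`. It is computed in the preferred chart at `γ t` as
`∑_k (V̇^k + ∑_{i,j} Γ^k_{ij} ẋ^i V^j) ∂_k`. -/
def covDerivAlong (γ : ℝ → M) (V : ∀ t, TangentSpace (𝓡 2) (γ t)) (t : ℝ) :
    TangentSpace (𝓡 2) (γ t) :=
  ∑ k, (deriv (fun s ↦ coordComp (γ t) (γ s) (V s) k) t +
      ∑ i, ∑ j, christoffel (γ t) (extChartAt (𝓡 2) (γ t) (γ t)) k i j *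
        coordComp (γ t) (γ t) (velocity γ t) i * coordComp (γ t) (γ t) (V t) j) •
    coordVec (γ t) (γ t) k

/-- Complete unit speed geodesics: curves defined on the whole real line, of unit speed, that
satisfy the geodesic equation `D γ'/dt = 0`. -/
structure IsUnitGeodesic (γ : ℝ → M) : Prop where
  contMDiff : ContMDiff 𝓘(ℝ, ℝ) (𝓡 2) 2 γ
  norm_velocity : ∀ t, ‖velocity γ t‖ = 1
  geodesic_eq : ∀ t, covDerivAlong γ (velocity γ) t = 0

variable (M) in
/-- The unit tangent bundle `T¹M`. -/
def UnitTangentBundle : Type _ :=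
  {v : TangentBundle (𝓡 2) M // ‖v.2‖ = 1}

instance : TopologicalSpace (UnitTangentBundle M) :=
  inferInstanceAs (TopologicalSpace {v : TangentBundle (𝓡 2) M // ‖v.2‖ = 1})

instance : MeasurableSpace (UnitTangentBundle M) := borel _

instance : BorelSpace (UnitTangentBundle M) := ⟨rfl⟩

/-- The orbit `t ↦ γ'(t)` in `T¹M` of a unit speed geodesic. -/
def IsUnitGeodesic.lift {γ : ℝ → M} (hγ : IsUnitGeodesic γ) (t : ℝ) : UnitTangentBundle M :=
  ⟨⟨γ t, velocity γ t⟩, hγ.norm_velocity t⟩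

open Classical in
/-- The geodesic flow `g_t` on `T¹M`: `g_t(v) = γ'(t)`, where `γ` is the unit speed geodesic with
`γ'(0) = v`. On a compact surface this geodesic exists for every `v`, and it is unique; the
value `v` in the absence of such a geodesic is a convention. -/
def geodesicFlow (t : ℝ) (v : UnitTangentBundle M) : UnitTangentBundle M :=
  if h : ∃ (γ : ℝ → M) (hγ : IsUnitGeodesic γ), hγ.lift 0 = v then h.choose_spec.choose.lift t
  else v

/-- Measures on `T¹M` that are invariant and ergodic for the geodesic flow. -/
structure IsErgodicInvariant (μ : Measure (UnitTangentBundle M)) : Prop where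
  invariant : ∀ t, MeasurePreserving (geodesicFlow t) μ μ
  ergodic : ∀ A : Set (UnitTangentBundle M), MeasurableSet A →
    (∀ t, geodesicFlow t ⁻¹' A = A) → μ A = 0 ∨ μ Aᶜ = 0

/-- The Dirac measure on the closed geodesic `γ` of period `T`: the invariant probability measure
`(1/T) ∫_0^T δ_{γ'(t)} dt` carried by the closed orbit `γ'` in `T¹M`. -/
def closedGeodesicMeasure {γ : ℝ → M} (hγ : IsUnitGeodesic γ) (T : ℝ) :
    Measure (UnitTangentBundle M) :=
  (ENNReal.ofReal T)⁻¹ • (volume.restrict (Ioc 0 T)).map hγ.lift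

/-- The length of the curve `c` in `TM`, on `[0, 1]`, for the natural (Sasaki) metric: the squared
norm of the velocity of `c = (γ, V)` is `|γ'|² + |DV/dt|²`. -/
def sasakiLength (c : ℝ → TangentBundle (𝓡 2) M) : ℝ≥0∞ :=
  ∫⁻ t in Icc (0 : ℝ) 1, ENNReal.ofReal
    (Real.sqrt (‖velocity (fun s ↦ (c s).1) t‖ ^ 2 +
      ‖covDerivAlong (fun s ↦ (c s).1) (fun s ↦ (c s).2) t‖ ^ 2))

/-- The distance on `T¹M` of the Riemannian metric that the Sasaki metric of `TM` induces on the
submanifold `T¹M`: the infimum of the lengths of the `C¹` curves in `T¹M` from `v` to `w`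
(infinite if there is no such curve). -/
def sasakiEDist (v w : UnitTangentBundle M) : ℝ≥0∞ :=
  ⨅ (c : ℝ → UnitTangentBundle M)
    (_ : ContMDiff 𝓘(ℝ, ℝ) (𝓡 2).tangent 1 (fun t ↦ (c t).1)) (_ : c 0 = v) (_ : c 1 = w),
    sasakiLength (fun t ↦ (c t).1)

/-- The `ε`-neighbourhood of a subset of `T¹M`. -/
def sasakiNhd (ε : ℝ) (A : Set (UnitTangentBundle M)) : Set (UnitTangentBundle M) :=
  {y | ∃ x ∈ A, sasakiEDist x y < ENNReal.ofReal ε}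

/-- The Prohorov distance between Borel probability measures on `T¹M`. -/
def prohorovDist (μ ν : Measure (UnitTangentBundle M)) : ℝ :=
  sInf {ε : ℝ | 0 < ε ∧ ∀ A : Set (UnitTangentBundle M), MeasurableSet A →
    μ A ≤ ν (sasakiNhd ε A) + ENNReal.ofReal ε}

/-- The closed strip `[0, l] × ℝ`, universal cover of the Euclidean cylinder of width `l`. -/
def strip (l : ℝ) : Set Plane := {x | 0 ≤ x 0 ∧ x 0 ≤ l}

/-- `Φ` is (the lift to the strip of) a Riemannian isometry from the Euclidean cylinder
`[0, l] × ℝ / 2πhℤ` onto an embedded cylinder of `M`: it is smooth up to the boundary, it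
preserves the metric, and two points of the strip have the same image if and only if they
represent the same point of the cylinder. -/
structure IsEmbeddedCylinder (l h : ℝ) (Φ : Plane → M) : Prop where
  contMDiffOn : ContMDiffOn 𝓘(ℝ, Plane) (𝓡 2) ∞ Φ (strip l)
  norm_mfderiv : ∀ x ∈ strip l, ∀ w : Plane,
    ‖(mfderivWithin 𝓘(ℝ, Plane) (𝓡 2) Φ (strip l) x w : TangentSpace (𝓡 2) (Φ x))‖ = ‖w‖
  eq_iff : ∀ x ∈ strip l, ∀ y ∈ strip l,
    Φ x = Φ y ↔ x 0 = y 0 ∧ ∃ n : ℤ, y 1 = x 1 + n * (2 * Real.pi * h)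

/-- The interior of the embedded cylinder. -/
def cylinderInterior (l : ℝ) (Φ : Plane → M) : Set M := Φ '' {x | 0 < x 0 ∧ x 0 < l}

/-- The boundary of the embedded cylinder. -/
def cylinderBoundary (l : ℝ) (Φ : Plane → M) : Set M := Φ '' {x | x 0 = 0 ∨ x 0 = l}

/-- The distance in `M` (infimum of lengths of curves of `M`) between two subsets of `M`. -/
def riemannianSetDist (A B : Set M) : ℝ≥0∞ :=
  ⨅ (x ∈ A) (y ∈ B), riemannianEDist (𝓡 2) x y

end Surface

end

/-! Test the Prohorov inequality on the set `A` of unit vectors based on `γ`, which has full mass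
for the Dirac measure. For `ε < d` a curve of Sasaki length less than `ε` starting in `A` projects
to a curve in `M` that is too short to reach the boundary of the cylinder, so the `ε`-neighbourhood
of `A` lies over a band of width `2ε` around `γ` (`mem_band_of_sasakiEDist_lt`). If the band has
`μ`-mass at most `2ε/l` (`measure_band_le`), then `1 ≤ 2ε/l + ε`, that is, `ε ≥ l/(l+2)`.

The mass bound rests on flatness: inside the cylinder a geodesic has constant axial speed `u`
(`geodesic_in_cylinder`). If `u ≠ 0`, a crossing takes time `l/|u|`, of which at most `2ε/|u|` is
spent in the band. Invariance of `μ` turns this ratio of times into a bound on masses by a Fubini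
argument on pairs (vector, time) weighted by `|u|/l`; no ergodic theorem is needed.

Ergodicity and full support serve to discard null sets. The vectors with `u = 0` form an invariant
set whose complement contains a nonempty open set, hence a null set
(`measure_setOf_vectorSpeed_eq_zero`). The same argument disposes of the transversal vectors at
which `geodesicFlow` takes its default value (`measure_setOf_not_hasGeodesic`), so completeness of
the geodesic flow is never proved; uniqueness of geodesics is not needed either, since every
statement holds along whichever geodesic the flow selects. -/

noncomputable section

/-! ### Flat charts of the cylinder from the inverse function theorem. -/

section FlatCharts

variable {M : Type*} [TopologicalSpace M] [ChartedSpace Plane M] [IsManifold (𝓡 2) ∞ M]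
variable [RiemannianBundle (fun x : M ↦ TangentSpace (𝓡 2) x)]

/-- A flat chart on an open set `W` of a surface: a `C²` map to the Euclidean plane that preserves
the metric. -/
structure IsFlatChart (W : Set M) (ψ : M → Plane) : Prop where
  isOpen : IsOpen W
  contMDiffOn : ContMDiffOn (𝓡 2) 𝓘(ℝ, Plane) 2 ψ W
  norm_mfderiv : ∀ q ∈ W, ∀ v : TangentSpace (𝓡 2) q,
    norm (E := Plane) (mfderiv (𝓡 2) 𝓘(ℝ, Plane) ψ q v) = ‖v‖

/-- The open strip `(0, l) × ℝ`. -/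
def openStrip (l : ℝ) : Set Plane := {x | 0 < x 0 ∧ x 0 < l}

lemma continuous_plane_coord (i : Fin 2) : Continuous fun x : Plane ↦ x i :=
  (EuclideanSpace.proj i : Plane →L[ℝ] ℝ).continuous

lemma isOpen_openStrip (l : ℝ) : IsOpen (openStrip l) :=
  (isOpen_lt continuous_const (continuous_plane_coord 0)).inter
    (isOpen_lt (continuous_plane_coord 0) continuous_const)

lemma openStrip_subset_strip (l : ℝ) : openStrip l ⊆ strip l := fun _ hx ↦ ⟨hx.1.le, hx.2.le⟩

lemma strip_mem_nhds {l : ℝ} {x : Plane} (hx : x ∈ openStrip l) : strip l ∈ 𝓝 x :=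
  Filter.mem_of_superset ((isOpen_openStrip l).mem_nhds hx) (openStrip_subset_strip l)

variable {l h : ℝ} {Φ : Plane → M}

namespace IsEmbeddedCylinder

omit [IsManifold (𝓡 2) ∞ M] in
lemma contMDiffAt (hΦ : IsEmbeddedCylinder l h Φ) {x : Plane} (hx : x ∈ openStrip l) :
    ContMDiffAt 𝓘(ℝ, Plane) (𝓡 2) ∞ Φ x :=
  (hΦ.contMDiffOn x (openStrip_subset_strip l hx)).contMDiffAt (strip_mem_nhds hx)

omit [IsManifold (𝓡 2) ∞ M] in
lemma norm_mfderiv_of_mem_openStrip (hΦ : IsEmbeddedCylinder l h Φ) {x : Plane}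
    (hx : x ∈ openStrip l) (w : Plane) :
    ‖(mfderiv 𝓘(ℝ, Plane) (𝓡 2) Φ x w : TangentSpace (𝓡 2) (Φ x))‖ = ‖w‖ := by
  rw [← hΦ.norm_mfderiv x (openStrip_subset_strip l hx) w,
    mfderivWithin_of_mem_nhds (strip_mem_nhds hx)]

/-- Near every point of the interior of an embedded flat cylinder, `Φ` has a local inverse, which
is a flat chart. -/
lemma exists_isFlatChart (hΦ : IsEmbeddedCylinder l h Φ) {x : Plane} (hx : x ∈ openStrip l) :
    ∃ (W : Set M) (ψ : M → Plane), Φ x ∈ W ∧ IsFlatChart W ψ ∧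
      ∀ q ∈ W, ψ q ∈ openStrip l ∧ Φ (ψ q) = q := by
  set φ := extChartAt (𝓡 2) (Φ x) with hφ
  have hΦx : ContMDiffAt 𝓘(ℝ, Plane) (𝓡 2) 2 Φ x :=
    (hΦ.contMDiffAt hx).of_le (WithTop.coe_le_coe.2 le_top)
  have hF : ContDiffAt ℝ 2 (φ ∘ Φ) x := by
    rw [← contMDiffAt_iff_contDiffAt]
    exact ContMDiffAt.comp x (contMDiffAt_extChartAt (n := 2)) hΦx
  have hd : ∀ w : Plane, fderiv ℝ (φ ∘ Φ) x w =
      mfderiv (𝓡 2) 𝓘(ℝ, Plane) φ (Φ x) (mfderiv 𝓘(ℝ, Plane) (𝓡 2) Φ x w) := fun w ↦ by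
    rw [← mfderiv_eq_fderiv]
    exact mfderiv_comp_apply x (mdifferentiableAt_extChartAt (mem_chart_source _ _))
      (hΦx.mdifferentiableAt (by norm_num)) w
  -- `Φ` preserves norms, so its differential kills no vector; this is what the inverse function
  -- theorem needs.
  have hinj : Function.Injective (fderiv ℝ (φ ∘ Φ) x) := by
    refine (injective_iff_map_eq_zero _).2 fun w hw ↦ ?_
    have h1 := (isInvertible_mfderiv_extChartAt (I := 𝓡 2) (mem_extChartAt_source (Φ x))).injective
    have h2 : mfderiv 𝓘(ℝ, Plane) (𝓡 2) Φ x w = 0 :=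
      h1 ((hd w).symm.trans (hw.trans (map_zero (mfderiv (𝓡 2) 𝓘(ℝ, Plane) φ (Φ x))).symm))
    have h3 := hΦ.norm_mfderiv_of_mem_openStrip hx w
    rw [h2, norm_zero] at h3
    exact norm_eq_zero.1 h3.symm
  set e : Plane ≃L[ℝ] Plane :=
    (LinearEquiv.ofInjectiveEndo (fderiv ℝ (φ ∘ Φ) x : Plane →ₗ[ℝ] Plane) hinj).toContinuousLinearEquiv
  have he : HasFDerivAt (φ ∘ Φ) (e : Plane →L[ℝ] Plane) x := by
    have : (e : Plane →L[ℝ] Plane) = fderiv ℝ (φ ∘ Φ) x := by ext; rfl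
    rw [this]
    exact (hF.differentiableAt (by norm_num)).hasFDerivAt
  set G := hF.localInverse he (by norm_num)
  have hG : ContDiffAt ℝ 2 G ((φ ∘ Φ) x) := hF.to_localInverse he (by norm_num)
  have hGx : G ((φ ∘ Φ) x) = x := hF.localInverse_apply_image he (by norm_num)
  have hGr : ∀ᶠ y in 𝓝 ((φ ∘ Φ) x), (φ ∘ Φ) (G y) = y :=
    (hF.hasStrictFDerivAt' he (by norm_num)).eventually_right_inverse
  have hφc : ContMDiffAt (𝓡 2) 𝓘(ℝ, Plane) 2 φ (Φ x) := contMDiffAt_extChartAt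
  have hψ : ContMDiffAt (𝓡 2) 𝓘(ℝ, Plane) 2 (G ∘ φ) (Φ x) :=
    ContMDiffAt.comp (Φ x) hG.contMDiffAt hφc
  have hψx : (G ∘ φ) (Φ x) = x := hGx
  have ev1 : ∀ᶠ q in 𝓝 (Φ x), ContMDiffAt (𝓡 2) 𝓘(ℝ, Plane) 2 (G ∘ φ) q :=
    ((contMDiffAt_iff_contMDiffAt_nhds (by simp)).1 hψ)
  have ev2 : ∀ᶠ q in 𝓝 (Φ x), (G ∘ φ) q ∈ openStrip l :=
    hψ.continuousAt.eventually_mem ((isOpen_openStrip l).mem_nhds (by rw [hψx]; exact hx))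
  -- The local inverse only gives an equality after applying `φ`; with both points in the source of
  -- `φ`, injectivity removes it.
  have ev3 : ∀ᶠ q in 𝓝 (Φ x), Φ ((G ∘ φ) q) ∈ φ.source := by
    have : ContinuousAt (Φ ∘ (G ∘ φ)) (Φ x) :=
      ContinuousAt.comp (by rw [hψx]; exact hΦx.continuousAt) hψ.continuousAt
    refine this.eventually_mem ?_
    simp only [Function.comp_apply] at hψx ⊢
    rw [hψx]
    exact extChartAt_source_mem_nhds _
  have ev4 : ∀ᶠ q in 𝓝 (Φ x), q ∈ φ.source := extChartAt_source_mem_nhds _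
  have ev5 : ∀ᶠ q in 𝓝 (Φ x), (φ ∘ Φ) (G (φ q)) = φ q := hφc.continuousAt.eventually hGr
  obtain ⟨W, hW, hWo, hxW⟩ := eventually_nhds_iff.1 (ev1.and (ev2.and (ev3.and (ev4.and ev5))))
  have hinv : ∀ q ∈ W, Φ ((G ∘ φ) q) = q := fun q hq ↦
    φ.injOn (hW q hq).2.2.1 (hW q hq).2.2.2.1 (hW q hq).2.2.2.2
  refine ⟨W, G ∘ φ, hxW, ⟨hWo, fun q hq ↦ (hW q hq).1.contMDiffWithinAt, fun q hq v ↦ ?_⟩,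
    fun q hq ↦ ⟨(hW q hq).2.1, hinv q hq⟩⟩
  have hm := (hW q hq).1.mdifferentiableAt (by norm_num)
  have hid : HasMFDerivAt (𝓡 2) (𝓡 2) (Φ ∘ (G ∘ φ)) q (ContinuousLinearMap.id ℝ _) :=
    (hasMFDerivAt_id q).congr_of_eventuallyEq
      (Filter.eventuallyEq_of_mem (hWo.mem_nhds hq) fun q' hq' ↦ hinv q' hq')
  have hcomp : mfderiv (𝓡 2) (𝓡 2) (Φ ∘ (G ∘ φ)) q v = mfderiv 𝓘(ℝ, Plane) (𝓡 2) Φ ((G ∘ φ) q)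
      (mfderiv (𝓡 2) 𝓘(ℝ, Plane) (G ∘ φ) q v) :=
    mfderiv_comp_apply q ((hΦ.contMDiffAt (hW q hq).2.1).mdifferentiableAt (by norm_num)) hm v
  rw [hid.mfderiv] at hcomp
  -- Tangent spaces at all points are the same type, but the norm depends on the base point and must
  -- be transported along `Φ (ψ q) = q`.
  have hnorm : ∀ q', q' = q → ‖(show TangentSpace (𝓡 2) q' from v)‖ = ‖v‖ := by
    rintro _ rfl
    rfl
  refine (hΦ.norm_mfderiv_of_mem_openStrip (hW q hq).2.1 _).symm.trans ?_
  refine Eq.trans ?_ (hnorm _ (hinv q hq))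
  exact congrArg _ hcomp.symm

end IsEmbeddedCylinder

end FlatCharts

/-! ### The geodesic equation of a pulled-back Euclidean metric. -/

section FlatChristoffel

lemma plane_eq_sum_single (a : Plane) : a = ∑ i, a i • EuclideanSpace.single i (1 : ℝ) := by
  ext j
  fin_cases j <;> simp [Fin.sum_univ_two]

/-- The Gram matrix of an invertible linear map of the plane is invertible. -/
lemma isUnit_det_gram {D : Plane →L[ℝ] Plane} (hD : Function.Injective D)
    {g : Matrix (Fin 2) (Fin 2) ℝ}
    (hg : ∀ i j, g i j = inner ℝ (D (EuclideanSpace.single i 1)) (D (EuclideanSpace.single j 1))) :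
    IsUnit g.det := by
  rw [isUnit_iff_ne_zero]
  intro h0
  obtain ⟨v, hv, hgv⟩ := Matrix.exists_mulVec_eq_zero_iff.2 h0
  apply hv
  set w : Plane := WithLp.toLp 2 v with hw
  -- The quadratic form of `g` is `‖D w‖²`, so a kernel vector of `g` is killed by `D`.
  have h1 : inner ℝ (D w) (D w) = ∑ i, v i * ∑ j, g i j * v j := by
    conv_lhs => rw [plane_eq_sum_single w]
    simp only [Fin.sum_univ_two, map_add, map_smul, inner_add_left, inner_add_right,
      inner_smul_left, inner_smul_right, hg, hw, conj_trivial]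
    ring
  have h2 : ∀ i, ∑ j, g i j * v j = 0 := fun i ↦ congrFun hgv i
  simp only [h2, mul_zero, Finset.sum_const_zero, inner_self_eq_zero] at h1
  have h3 : w = 0 := hD (by rw [h1, map_zero])
  ext i
  simpa [hw] using congrArg (fun x : Plane ↦ x i) h3

/-- If the metric `g` is the pull-back of the Euclidean metric under `H`, then `H` maps solutions
of the geodesic equation of `g` to curves without acceleration. -/
theorem deriv_deriv_comp_eq_zero_of_geodesic_eq {H : Plane → Plane} {y : ℝ → Plane} {t : ℝ}
    {g : Plane → Matrix (Fin 2) (Fin 2) ℝ}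
    (hH : ContDiffAt ℝ 2 H (y t)) (hinj : Function.Injective (fderiv ℝ H (y t)))
    (hg : ∀ᶠ z in 𝓝 (y t), ∀ i j, g z i j =
      inner ℝ (fderiv ℝ H z (EuclideanSpace.single i 1)) (fderiv ℝ H z (EuclideanSpace.single j 1)))
    (hy : ContDiffAt ℝ 2 y t)
    (hgeo : ∀ k, deriv (fun s ↦ deriv y s k) t + ∑ i, ∑ j,
      ((1 / 2 : ℝ) * ∑ m, (g (y t))⁻¹ k m *
        (fderiv ℝ (fun z ↦ g z j m) (y t) (EuclideanSpace.single i 1) +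
          fderiv ℝ (fun z ↦ g z i m) (y t) (EuclideanSpace.single j 1) -
          fderiv ℝ (fun z ↦ g z i j) (y t) (EuclideanSpace.single m 1))) *
        deriv y t i * deriv y t j = 0) :
    deriv (deriv (H ∘ y)) t = 0 := by
  set D := fderiv ℝ H with hDdef
  set e : Fin 2 → Plane := fun i ↦ EuclideanSpace.single i 1 with he
  have hD : DifferentiableAt ℝ D (y t) :=
    (hH.fderiv_right (m := 1) (by norm_num)).differentiableAt (by norm_num)
  set D2 := fderiv ℝ D (y t) with hD2
  have hsymm : ∀ u v, D2 u v = D2 v u := fun u v ↦ (hH.isSymmSndFDerivAt (by simp)) u v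
  have happ : ∀ w, HasFDerivAt (fun z ↦ D z w) (D2.flip w) (y t) := fun w ↦ by
    simpa using hD.hasFDerivAt.clm_apply (hasFDerivAt_const w (y t))
  have hgd : ∀ i j w, fderiv ℝ (fun z ↦ g z i j) (y t) w =
      inner ℝ (D2 w (e i)) (D (y t) (e j)) + inner ℝ (D (y t) (e i)) (D2 w (e j)) := fun i j w ↦ by
    have h1 : (fun z ↦ g z i j) =ᶠ[𝓝 (y t)] fun z ↦ inner ℝ (D z (e i)) (D z (e j)) :=
      hg.mono fun z hz ↦ hz i j
    rw [h1.fderiv_eq, ((happ (e i)).inner ℝ (happ (e j))).fderiv]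
    simp [fderivInnerCLM_apply]
    ring
  have hy1 : DifferentiableAt ℝ y t := hy.differentiableAt (by norm_num)
  have hyd : DifferentiableAt ℝ (deriv y) t :=
    ((hy.fderiv_right (m := 1) (by norm_num)).differentiableAt (by norm_num)).clm_apply
      (differentiableAt_const (1 : ℝ))
  have hcomp : deriv (H ∘ y) =ᶠ[𝓝 t] fun s ↦ D (y s) (deriv y s) := by
    have e1 : ∀ᶠ s in 𝓝 t, ContDiffAt ℝ 2 y s := hy.eventually (by simp)
    have e2 : ∀ᶠ s in 𝓝 t, ContDiffAt ℝ 2 H (y s) :=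
      hy.continuousAt.eventually (hH.eventually (by simp))
    filter_upwards [e1, e2] with s h1 h2
    exact ((h2.differentiableAt (by norm_num)).hasFDerivAt.comp_hasDerivAt s
      (h1.differentiableAt (by norm_num)).hasDerivAt).deriv
  set a := deriv y t with ha
  set c := deriv (deriv y) t with hc
  have hz : deriv (deriv (H ∘ y)) t = D2 a a + D (y t) c := by
    rw [hcomp.deriv_eq]
    exact ((hD.hasFDerivAt.comp_hasDerivAt t hy1.hasDerivAt).clm_apply hyd.hasDerivAt).deriv
  have hck : ∀ k, deriv (fun s ↦ deriv y s k) t = c k := fun k ↦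
    ((EuclideanSpace.proj k : Plane →L[ℝ] ℝ).hasFDerivAt.comp_hasDerivAt t hyd.hasDerivAt).deriv
  have hg0 := hg.self_of_nhds
  have hunit := isUnit_det_gram hinj hg0
  have hD2a : ∀ n, inner ℝ (D2 a a) (D (y t) (e n)) =
      ∑ i, ∑ j, a i * a j * inner ℝ (D2 (e i) (e j)) (D (y t) (e n)) := fun n ↦ by
    conv_lhs => rw [plane_eq_sum_single a]
    simp only [Fin.sum_univ_two, map_add, map_smul, add_apply, smul_apply, inner_add_left,
      inner_smul_left, smul_add, he, conj_trivial]
    ring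
  have hcm : ∀ k, c k = - ∑ m, (g (y t))⁻¹ k m * inner ℝ (D2 a a) (D (y t) (e m)) := fun k ↦ by
    have h1 := hgeo k
    rw [hck] at h1
    rw [eq_neg_iff_add_eq_zero, ← h1]
    congr 1
    simp only [hD2a]
    -- Christoffel symbols of the first kind: by symmetry of the second derivative, two of the three
    -- pairs of terms cancel and the third doubles.
    have h2 : ∀ i j m, fderiv ℝ (fun z ↦ g z j m) (y t) (e i) +
        fderiv ℝ (fun z ↦ g z i m) (y t) (e j) - fderiv ℝ (fun z ↦ g z i j) (y t) (e m) =
        2 * inner ℝ (D2 (e i) (e j)) (D (y t) (e m)) := fun i j m ↦ by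
      rw [hgd, hgd, hgd, hsymm (e j) (e i), hsymm (e m) (e i), hsymm (e m) (e j),
        real_inner_comm (D (y t) (e j)) (D2 (e i) (e m))]
      ring
    simp only [he] at h2 ⊢
    simp only [h2, Fin.sum_univ_two]
    ring
  -- Multiplying the geodesic equation by `g` cancels the inverse matrix: the acceleration `D2 a a +
  -- D c` of `H ∘ y` is orthogonal to each `D (e n)`.
  have hgc : ∀ n, inner ℝ (D (y t) c) (D (y t) (e n)) = - inner ℝ (D2 a a) (D (y t) (e n)) := by
    have hc' : c.ofLp = -((g (y t))⁻¹.mulVec fun m ↦ inner ℝ (D2 a a) (D (y t) (e m))) := by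
      ext k
      exact hcm k
    intro n
    have h1 : inner ℝ (D (y t) c) (D (y t) (e n)) = (g (y t)).mulVec c.ofLp n := by
      conv_lhs => rw [plane_eq_sum_single c]
      simp only [map_sum, map_smul, sum_inner, inner_smul_left, Matrix.mulVec, dotProduct, hg0]
      refine Finset.sum_congr rfl fun i _ ↦ ?_
      rw [real_inner_comm]
      simp [he]
      ring
    rw [h1, hc', Matrix.mulVec_neg, Matrix.mulVec_mulVec, Matrix.mul_nonsing_inv _ hunit,
      Matrix.one_mulVec]
    rfl
  -- In finite dimension the vectors `D (e i)` span, so the acceleration is some `D w`; being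
  -- orthogonal to all of them, it is orthogonal to itself.
  obtain ⟨w, hw⟩ := (LinearMap.injective_iff_surjective (f := (D (y t) : Plane →ₗ[ℝ] Plane))).1 hinj
    (D2 a a + D (y t) c)
  replace hw : D (y t) w = D2 a a + D (y t) c := hw
  rw [hz, ← hw, ← inner_self_eq_zero (𝕜 := ℝ)]
  have hperp : ∀ i, inner ℝ (D (y t) (e i)) (D (y t) w) = 0 := fun i ↦ by
    rw [hw, real_inner_comm, inner_add_left, hgc i]
    ring
  conv_lhs => enter [2]; rw [plane_eq_sum_single w]
  simp only [map_sum, map_smul, sum_inner, inner_smul_left]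
  refine Finset.sum_eq_zero fun i _ ↦ ?_
  rw [hperp i, mul_zero]

end FlatChristoffel

/-! ### Geodesics are straight in flat charts. -/

section GeodesicsInFlatCharts

variable {M : Type*} [TopologicalSpace M] [ChartedSpace Plane M] [IsManifold (𝓡 2) ∞ M]

lemma contMDiffAt_extChartAt_symm {p : M} {z : Plane} (hz : z ∈ (extChartAt (𝓡 2) p).target) :
    ContMDiffAt 𝓘(ℝ, Plane) (𝓡 2) 2 (extChartAt (𝓡 2) p).symm z :=
  (contMDiffOn_extChartAt_symm p).contMDiffAt ((isOpen_extChartAt_target p).mem_nhds hz)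

lemma coordVec_eq_mfderiv {p : M} {z : Plane} (hz : z ∈ (extChartAt (𝓡 2) p).target) (i : Fin 2) :
    coordVec p ((extChartAt (𝓡 2) p).symm z) i =
      mfderiv 𝓘(ℝ, Plane) (𝓡 2) (extChartAt (𝓡 2) p).symm z (EuclideanSpace.single i 1) := by
  have hs : (extChartAt (𝓡 2) p).symm z ∈ (chartAt Plane p).source := by
    rw [← extChartAt_source (𝓡 2)]
    exact (extChartAt (𝓡 2) p).map_target hz
  unfold coordVec
  rw [TangentBundle.symmL_trivializationAt hs]
  simp only [modelWithCornersSelf_coe, range_id, mfderivWithin_univ]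
  rw [(extChartAt (𝓡 2) p).right_inv hz]
  rfl

lemma coordComp_eq_mfderiv {p q : M} (hq : q ∈ (chartAt Plane p).source)
    (v : TangentSpace (𝓡 2) q) (i : Fin 2) :
    coordComp p q v i =
      (EuclideanSpace.proj i : Plane →L[ℝ] ℝ)
        (mfderiv (𝓡 2) 𝓘(ℝ, Plane) (extChartAt (𝓡 2) p) q v) := by
  unfold coordComp
  rw [TangentBundle.continuousLinearMapAt_trivializationAt hq]
  rfl

/-- The components of the velocity of a curve are the derivatives of its coordinates. -/
lemma coordComp_velocity {p : M} {γ : ℝ → M} {s : ℝ} (hs : γ s ∈ (chartAt Plane p).source)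
    (hγ : MDifferentiableAt 𝓘(ℝ, ℝ) (𝓡 2) γ s) (i : Fin 2) :
    coordComp p (γ s) (velocity γ s) i = deriv (extChartAt (𝓡 2) p ∘ γ) s i := by
  rw [coordComp_eq_mfderiv hs, ← fderiv_apply_one_eq_deriv, ← mfderiv_eq_fderiv]
  exact congrArg (fun w : Plane ↦ w i)
    (mfderiv_comp_apply s (mdifferentiableAt_extChartAt hs) hγ (1 : ℝ)).symm

lemma coordComp_sum_smul_coordVec (p : M) (c : Fin 2 → ℝ) (k : Fin 2) :
    coordComp p p (∑ i, c i • coordVec p p i) k = c k := by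
  have h : ∀ i, (trivializationAt Plane (TangentSpace (𝓡 2)) p).continuousLinearMapAt ℝ p
      (coordVec p p i) = EuclideanSpace.single i 1 := fun i ↦
    Trivialization.continuousLinearMapAt_symmL _ (mem_baseSet_trivializationAt _ _ p) _
  unfold coordComp
  rw [map_sum]
  simp only [map_smul, h]
  fin_cases k <;> simp [Fin.sum_univ_two]

variable [RiemannianBundle (fun x : M ↦ TangentSpace (𝓡 2) x)]

namespace IsFlatChart

variable {W : Set M} {ψ : M → Plane}

omit [IsManifold (𝓡 2) ∞ M] in
lemma contMDiffAt (hψ : IsFlatChart W ψ) {q : M} (hq : q ∈ W) :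
    ContMDiffAt (𝓡 2) 𝓘(ℝ, Plane) 2 ψ q :=
  hψ.contMDiffOn.contMDiffAt (hψ.isOpen.mem_nhds hq)

omit [IsManifold (𝓡 2) ∞ M] in
lemma mdifferentiableAt (hψ : IsFlatChart W ψ) {q : M} (hq : q ∈ W) :
    MDifferentiableAt (𝓡 2) 𝓘(ℝ, Plane) ψ q :=
  (hψ.contMDiffAt hq).mdifferentiableAt (by norm_num)

omit [IsManifold (𝓡 2) ∞ M] in
-- Polarization of the norm identity.
lemma inner_mfderiv (hψ : IsFlatChart W ψ) {q : M} (hq : q ∈ W) (v w : TangentSpace (𝓡 2) q) :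
    inner ℝ (E := Plane) (mfderiv (𝓡 2) 𝓘(ℝ, Plane) ψ q v) (mfderiv (𝓡 2) 𝓘(ℝ, Plane) ψ q w) =
      inner ℝ v w := by
  set L : TangentSpace (𝓡 2) q →L[ℝ] Plane := mfderiv (𝓡 2) 𝓘(ℝ, Plane) ψ q
  have hL : ∀ u, ‖L u‖ = ‖u‖ := hψ.norm_mfderiv q hq
  change inner ℝ (L v) (L w) = _
  rw [real_inner_eq_norm_add_mul_self_sub_norm_mul_self_sub_norm_mul_self_div_two,
    real_inner_eq_norm_add_mul_self_sub_norm_mul_self_sub_norm_mul_self_div_two,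
    ← map_add, hL, hL, hL]

lemma fderiv_comp_extChartAt_symm (hψ : IsFlatChart W ψ) {p : M} {z : Plane}
    (hz : z ∈ (extChartAt (𝓡 2) p).target) (hzW : (extChartAt (𝓡 2) p).symm z ∈ W) (w : Plane) :
    fderiv ℝ (ψ ∘ (extChartAt (𝓡 2) p).symm) z w =
      mfderiv (𝓡 2) 𝓘(ℝ, Plane) ψ ((extChartAt (𝓡 2) p).symm z)
        (mfderiv 𝓘(ℝ, Plane) (𝓡 2) (extChartAt (𝓡 2) p).symm z w) := by
  rw [← mfderiv_eq_fderiv]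
  exact mfderiv_comp_apply z (hψ.mdifferentiableAt hzW)
    ((contMDiffAt_extChartAt_symm hz).mdifferentiableAt (by norm_num)) w

lemma injective_fderiv_comp_extChartAt_symm (hψ : IsFlatChart W ψ) {p : M} {z : Plane}
    (hz : z ∈ (extChartAt (𝓡 2) p).target) (hzW : (extChartAt (𝓡 2) p).symm z ∈ W) :
    Function.Injective (fderiv ℝ (ψ ∘ (extChartAt (𝓡 2) p).symm) z) := by
  refine (injective_iff_map_eq_zero _).2 fun w hw ↦ ?_
  rw [hψ.fderiv_comp_extChartAt_symm hz hzW] at hw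
  have h1 := hψ.norm_mfderiv _ hzW (mfderiv 𝓘(ℝ, Plane) (𝓡 2) (extChartAt (𝓡 2) p).symm z w)
  rw [hw] at h1
  have h2 := norm_eq_zero.1 (h1.symm.trans (norm_zero (E := Plane)))
  have h3 := (isInvertible_mfderivWithin_extChartAt_symm (I := 𝓡 2) hz).injective
  simp only [modelWithCornersSelf_coe, range_id, mfderivWithin_univ] at h3
  exact h3 (h2.trans (map_zero _).symm)

lemma metricMatrix_eq (hψ : IsFlatChart W ψ) {p : M} {z : Plane}
    (hz : z ∈ (extChartAt (𝓡 2) p).target) (hzW : (extChartAt (𝓡 2) p).symm z ∈ W) (i j : Fin 2) :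
    metricMatrix p z i j =
      inner ℝ (fderiv ℝ (ψ ∘ (extChartAt (𝓡 2) p).symm) z (EuclideanSpace.single i 1))
        (fderiv ℝ (ψ ∘ (extChartAt (𝓡 2) p).symm) z (EuclideanSpace.single j 1)) := by
  rw [hψ.fderiv_comp_extChartAt_symm hz hzW, hψ.fderiv_comp_extChartAt_symm hz hzW,
    hψ.inner_mfderiv hzW, ← coordVec_eq_mfderiv hz, ← coordVec_eq_mfderiv hz]
  rfl

/-- In a flat chart, geodesics have no acceleration. -/
theorem deriv_deriv_comp_geodesic (hψ : IsFlatChart W ψ) {γ : ℝ → M} (hγ : IsUnitGeodesic γ)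
    {t : ℝ} (ht : γ t ∈ W) : deriv (deriv (ψ ∘ γ)) t = 0 := by
  set φ := extChartAt (𝓡 2) (γ t) with hφ
  have hsrc : ∀ᶠ s in 𝓝 t, γ s ∈ φ.source :=
    hγ.contMDiff.continuous.continuousAt.eventually (extChartAt_source_mem_nhds (γ t))
  have heq : ψ ∘ γ =ᶠ[𝓝 t] (ψ ∘ φ.symm) ∘ (φ ∘ γ) :=
    hsrc.mono fun s hs ↦ congrArg ψ (φ.left_inv hs).symm
  rw [heq.deriv.deriv_eq]
  have htgt : φ (γ t) ∈ φ.target := mem_extChartAt_target (γ t)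
  have hinv : φ.symm (φ (γ t)) = γ t := extChartAt_to_inv (γ t)
  have hzW : φ.symm ((φ ∘ γ) t) ∈ W := by
    rw [Function.comp_apply, hinv]
    exact ht
  have hd : ∀ s, MDifferentiableAt 𝓘(ℝ, ℝ) (𝓡 2) γ s := fun s ↦
    hγ.contMDiff.contMDiffAt.mdifferentiableAt (by norm_num)
  have hcomp : ∀ᶠ s in 𝓝 t, ∀ k,
      coordComp (γ t) (γ s) (velocity γ s) k = deriv (φ ∘ γ) s k :=
    hsrc.mono fun s hs k ↦ coordComp_velocity (by rwa [hφ, extChartAt_source] at hs) (hd s) k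
  -- Here `H` is the transition map from the preferred chart at `γ t` to the flat chart, and `y` is
  -- the geodesic in preferred coordinates.
  refine deriv_deriv_comp_eq_zero_of_geodesic_eq (g := metricMatrix (γ t)) ?_
    (hψ.injective_fderiv_comp_extChartAt_symm htgt hzW) ?_ ?_ fun k ↦ ?_
  · rw [← contMDiffAt_iff_contDiffAt]
    exact ContMDiffAt.comp _ (hψ.contMDiffAt hzW) (contMDiffAt_extChartAt_symm htgt)
  · have e1 : ∀ᶠ z in 𝓝 (φ (γ t)), φ.symm z ∈ W :=
      (contMDiffAt_extChartAt_symm htgt).continuousAt.eventually_mem (hψ.isOpen.mem_nhds hzW)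
    filter_upwards [e1, (isOpen_extChartAt_target (γ t)).mem_nhds htgt] with z h1 h2 i j
    exact hψ.metricMatrix_eq h2 h1 i j
  · rw [← contMDiffAt_iff_contDiffAt]
    exact ContMDiffAt.comp t (contMDiffAt_extChartAt (n := 2)) hγ.contMDiff.contMDiffAt
  · have h1 := congrArg (fun v ↦ coordComp (γ t) (γ t) v k) (hγ.geodesic_eq t)
    simp only [covDerivAlong] at h1
    rw [coordComp_sum_smul_coordVec] at h1
    have h2 : (fun s ↦ coordComp (γ t) (γ s) (velocity γ s) k) =ᶠ[𝓝 t]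
        fun s ↦ deriv (φ ∘ γ) s k := hcomp.mono fun s hs ↦ hs k
    rw [h2.deriv_eq] at h1
    simp only [hcomp.self_of_nhds] at h1
    refine Eq.trans ?_ (h1.trans ?_)
    · rfl
    · unfold coordComp
      rw [map_zero]
      rfl

end IsFlatChart

end GeodesicsInFlatCharts

/-! ### The axial coordinate, and its linear growth along geodesics. -/

section AxialCoordinate

variable {M : Type*} [TopologicalSpace M] [ChartedSpace Plane M]

open Classical in
/-- The first coordinate, with values in `(0, l)`, on the interior of an embedded cylinder
(and `0` elsewhere). -/
def axialCoord (l : ℝ) (Φ : Plane → M) (q : M) : ℝ :=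
  if h : ∃ x ∈ openStrip l, Φ x = q then h.choose 0 else 0

/-- The component along the axis of the cylinder of a tangent vector. -/
def axialSpeed (l : ℝ) (Φ : Plane → M) (q : M) (v : TangentSpace (𝓡 2) q) : ℝ :=
  mfderiv (𝓡 2) 𝓘(ℝ, ℝ) (axialCoord l Φ) q v

variable [IsManifold (𝓡 2) ∞ M] [RiemannianBundle (fun x : M ↦ TangentSpace (𝓡 2) x)]
  {l h : ℝ} {Φ : Plane → M}

namespace IsEmbeddedCylinder

omit [IsManifold (𝓡 2) ∞ M] in
-- The choice in `axialCoord` is harmless: two preimages of a point differ by a translation of the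
-- second coordinate only.
lemma axialCoord_apply (hΦ : IsEmbeddedCylinder l h Φ) {x : Plane} (hx : x ∈ openStrip l) :
    axialCoord l Φ (Φ x) = x 0 := by
  have hex : ∃ y ∈ openStrip l, Φ y = Φ x := ⟨x, hx, rfl⟩
  rw [axialCoord, dif_pos hex]
  exact ((hΦ.eq_iff _ (openStrip_subset_strip l hex.choose_spec.1) _
    (openStrip_subset_strip l hx)).1 hex.choose_spec.2).1

omit [IsManifold (𝓡 2) ∞ M] in
lemma axialCoord_mem (hΦ : IsEmbeddedCylinder l h Φ) {q : M} (hq : q ∈ cylinderInterior l Φ) :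
    axialCoord l Φ q ∈ Ioo 0 l := by
  obtain ⟨x, hx, rfl⟩ := hq
  rw [hΦ.axialCoord_apply hx]
  exact hx

/-- Every interior point of the cylinder has a flat chart, the first coordinate of which is the
axial coordinate. -/
lemma exists_isFlatChart_axialCoord (hΦ : IsEmbeddedCylinder l h Φ) {q : M}
    (hq : q ∈ cylinderInterior l Φ) :
    ∃ (W : Set M) (ψ : M → Plane), q ∈ W ∧ IsFlatChart W ψ ∧ W ⊆ cylinderInterior l Φ ∧
      ∀ q' ∈ W, axialCoord l Φ q' = ψ q' 0 := by
  obtain ⟨x, hx, rfl⟩ := hq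
  obtain ⟨W, ψ, hxW, hψ, hW⟩ := hΦ.exists_isFlatChart hx
  refine ⟨W, ψ, hxW, hψ, fun q hq ↦ ⟨ψ q, hW q hq⟩, fun q hq ↦ ?_⟩
  conv_lhs => rw [← (hW q hq).2]
  exact hΦ.axialCoord_apply (hW q hq).1

lemma isOpen_cylinderInterior (hΦ : IsEmbeddedCylinder l h Φ) :
    IsOpen (cylinderInterior l Φ) := by
  refine isOpen_iff_mem_nhds.2 fun q hq ↦ ?_
  obtain ⟨W, ψ, hqW, hψ, hWC, -⟩ := hΦ.exists_isFlatChart_axialCoord hq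
  exact Filter.mem_of_superset (hψ.isOpen.mem_nhds hqW) hWC

lemma contMDiffOn_axialCoord (hΦ : IsEmbeddedCylinder l h Φ) :
    ContMDiffOn (𝓡 2) 𝓘(ℝ, ℝ) 2 (axialCoord l Φ) (cylinderInterior l Φ) := by
  intro q hq
  obtain ⟨W, ψ, hqW, hψ, -, hX⟩ := hΦ.exists_isFlatChart_axialCoord hq
  refine ContMDiffAt.contMDiffWithinAt ?_
  refine ContMDiffAt.congr_of_eventuallyEq
    (f := (EuclideanSpace.proj 0 : Plane →L[ℝ] ℝ) ∘ ψ) ?_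
    (Filter.eventuallyEq_of_mem (hψ.isOpen.mem_nhds hqW) hX)
  exact ContMDiffAt.comp q (ContinuousLinearMap.contMDiffAt _) (hψ.contMDiffAt hqW)

lemma mdifferentiableAt_axialCoord (hΦ : IsEmbeddedCylinder l h Φ) {q : M}
    (hq : q ∈ cylinderInterior l Φ) :
    MDifferentiableAt (𝓡 2) 𝓘(ℝ, ℝ) (axialCoord l Φ) q :=
  (hΦ.contMDiffOn_axialCoord.contMDiffAt
    (hΦ.isOpen_cylinderInterior.mem_nhds hq)).mdifferentiableAt (by norm_num)

omit [IsManifold (𝓡 2) ∞ M] in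
lemma axialSpeed_eq {W : Set M} {ψ : M → Plane} (hψ : IsFlatChart W ψ)
    (hX : ∀ q' ∈ W, axialCoord l Φ q' = ψ q' 0) {q : M} (hq : q ∈ W) (v : TangentSpace (𝓡 2) q) :
    axialSpeed l Φ q v =
      (EuclideanSpace.proj 0 : Plane →L[ℝ] ℝ) (mfderiv (𝓡 2) 𝓘(ℝ, Plane) ψ q v) := by
  have h1 : axialCoord l Φ =ᶠ[𝓝 q] (EuclideanSpace.proj 0 : Plane →L[ℝ] ℝ) ∘ ψ :=
    Filter.eventuallyEq_of_mem (hψ.isOpen.mem_nhds hq) hX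
  have h2 : HasMFDerivAt (𝓡 2) 𝓘(ℝ, ℝ) ((EuclideanSpace.proj 0 : Plane →L[ℝ] ℝ) ∘ ψ) q
      ((EuclideanSpace.proj 0 : Plane →L[ℝ] ℝ).comp
        (mfderiv (𝓡 2) 𝓘(ℝ, Plane) ψ q : TangentSpace (𝓡 2) q →L[ℝ] Plane)) :=
    HasMFDerivAt.comp q (ContinuousLinearMap.hasMFDerivAt _)
      (hψ.mdifferentiableAt hq).hasMFDerivAt
  exact congrArg (fun L ↦ L v) (h2.congr_of_eventuallyEq h1).mfderiv

lemma abs_axialSpeed_le (hΦ : IsEmbeddedCylinder l h Φ) {q : M} (hq : q ∈ cylinderInterior l Φ)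
    (v : TangentSpace (𝓡 2) q) : |axialSpeed l Φ q v| ≤ ‖v‖ := by
  obtain ⟨W, ψ, hqW, hψ, -, hX⟩ := hΦ.exists_isFlatChart_axialCoord hq
  rw [axialSpeed_eq hψ hX hqW, ← hψ.norm_mfderiv q hqW v]
  exact PiLp.norm_apply_le (show Plane from mfderiv (𝓡 2) 𝓘(ℝ, Plane) ψ q v) 0

/-- The differential of a flat chart is an injective, hence surjective, isometry, so `(u, 0)` lifts
to a unit vector. The lift will show that certain open sets of vectors are nonempty. -/
lemma exists_axialSpeed_eq (hΦ : IsEmbeddedCylinder l h Φ) {q : M}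
    (hq : q ∈ cylinderInterior l Φ) {u : ℝ} (hu : |u| = 1) :
    ∃ v : TangentSpace (𝓡 2) q, ‖v‖ = 1 ∧ axialSpeed l Φ q v = u := by
  obtain ⟨W, ψ, hqW, hψ, -, hX⟩ := hΦ.exists_isFlatChart_axialCoord hq
  set L : TangentSpace (𝓡 2) q →L[ℝ] Plane := mfderiv (𝓡 2) 𝓘(ℝ, Plane) ψ q
  have hL : ∀ v, ‖L v‖ = ‖v‖ := hψ.norm_mfderiv q hqW
  have hinj : ∀ v, L v = 0 → v = 0 := fun v hv ↦ by
    have h1 := hL v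
    rw [hv, norm_zero] at h1
    exact norm_eq_zero.1 h1.symm
  let f : Plane →ₗ[ℝ] Plane :=
    { toFun := fun w ↦ L w
      map_add' := fun a b ↦ L.map_add a b
      map_smul' := fun c a ↦ L.map_smul c a }
  have hf : Function.Injective f := (injective_iff_map_eq_zero f).2 hinj
  have hsurj : Function.Surjective f := LinearMap.injective_iff_surjective.1 hf
  obtain ⟨v, hv⟩ : ∃ v, L v = EuclideanSpace.single 0 u := hsurj _
  refine ⟨v, ?_, ?_⟩
  · have h1 := hL v
    rw [hv, PiLp.norm_single] at h1
    rw [← hu]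
    exact h1.symm
  · rw [axialSpeed_eq hψ hX hqW]
    refine (congrArg (EuclideanSpace.proj 0 : Plane →L[ℝ] ℝ) hv).trans ?_
    simp

/-- The axial speed is the derivative of the axial coordinate. -/
lemma hasDerivAt_axialCoord_comp (hΦ : IsEmbeddedCylinder l h Φ) {γ : ℝ → M} {t : ℝ}
    (hγ : MDifferentiableAt 𝓘(ℝ, ℝ) (𝓡 2) γ t) (ht : γ t ∈ cylinderInterior l Φ) :
    HasDerivAt (axialCoord l Φ ∘ γ) (axialSpeed l Φ (γ t) (velocity γ t)) t := by
  have h1 : HasFDerivAt (axialCoord l Φ ∘ γ)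
      (show ℝ →L[ℝ] ℝ from (mfderiv (𝓡 2) 𝓘(ℝ, ℝ) (axialCoord l Φ) (γ t)).comp
        (mfderiv 𝓘(ℝ, ℝ) (𝓡 2) γ t)) t :=
    (HasMFDerivAt.comp t (hΦ.mdifferentiableAt_axialCoord ht).hasMFDerivAt
      hγ.hasMFDerivAt).hasFDerivAt
  exact h1.hasDerivAt

/-- The axial speed of a geodesic is constant in the cylinder. -/
lemma hasDerivAt_axialSpeed_velocity (hΦ : IsEmbeddedCylinder l h Φ) {γ : ℝ → M}
    (hγ : IsUnitGeodesic γ) {t : ℝ} (ht : γ t ∈ cylinderInterior l Φ) :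
    HasDerivAt (fun s ↦ axialSpeed l Φ (γ s) (velocity γ s)) 0 t := by
  obtain ⟨W, ψ, hqW, hψ, hWC, hX⟩ := hΦ.exists_isFlatChart_axialCoord ht
  have hW : ∀ᶠ s in 𝓝 t, γ s ∈ W :=
    hγ.contMDiff.continuous.continuousAt.eventually_mem (hψ.isOpen.mem_nhds hqW)
  have hd : ∀ s, MDifferentiableAt 𝓘(ℝ, ℝ) (𝓡 2) γ s := fun s ↦
    hγ.contMDiff.contMDiffAt.mdifferentiableAt (by norm_num)
  have hcd : ContDiffAt ℝ 2 (ψ ∘ γ) t := by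
    rw [← contMDiffAt_iff_contDiffAt]
    exact ContMDiffAt.comp t (hψ.contMDiffAt hqW) hγ.contMDiff.contMDiffAt
  have hdd : HasDerivAt (deriv (ψ ∘ γ)) 0 t := by
    rw [← hψ.deriv_deriv_comp_geodesic hγ hqW]
    refine DifferentiableAt.hasDerivAt ?_
    exact ((hcd.fderiv_right (m := 1) (by norm_num)).differentiableAt (by norm_num)).clm_apply
      (differentiableAt_const (1 : ℝ))
  have heq : (fun s ↦ axialSpeed l Φ (γ s) (velocity γ s)) =ᶠ[𝓝 t]
      (EuclideanSpace.proj 0 : Plane →L[ℝ] ℝ) ∘ deriv (ψ ∘ γ) := by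
    filter_upwards [hW] with s hs
    rw [axialSpeed_eq hψ hX hs]
    refine congrArg (EuclideanSpace.proj 0 : Plane →L[ℝ] ℝ) ?_
    rw [← fderiv_apply_one_eq_deriv, ← mfderiv_eq_fderiv]
    exact (mfderiv_comp_apply s (hψ.mdifferentiableAt hs) (hd s) (1 : ℝ)).symm
  have h3 := ((EuclideanSpace.proj 0 : Plane →L[ℝ] ℝ).hasFDerivAt.comp_hasDerivAt t hdd)
  rw [map_zero] at h3
  exact h3.congr_of_eventuallyEq heq

omit [IsManifold (𝓡 2) ∞ M] in
/-- The closed subcylinders are compact. -/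
lemma isCompact_image (hΦ : IsEmbeddedCylinder l h Φ) (hh : 0 < h) {a b : ℝ} (ha : 0 ≤ a)
    (hb : b ≤ l) : IsCompact (Φ '' {x | a ≤ x 0 ∧ x 0 ≤ b}) := by
  have hp : 0 < 2 * Real.pi * h := by positivity
  set j : ℝ × ℝ → Plane := fun p ↦ !₂[p.1, p.2] with hj
  have hjc : Continuous j := by fun_prop
  set B := j '' (Icc a b ×ˢ Icc 0 (2 * Real.pi * h)) with hB
  have hBc : IsCompact B := (isCompact_Icc.prod isCompact_Icc).image hjc
  have hBs : B ⊆ strip l := by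
    rintro _ ⟨⟨s, t⟩, ⟨hs, -⟩, rfl⟩
    exact ⟨ha.trans hs.1, hs.2.trans hb⟩
  have himg : Φ '' {x | a ≤ x 0 ∧ x 0 ≤ b} = Φ '' B := by
    refine Subset.antisymm ?_ (image_mono ?_)
    · rintro _ ⟨x, hx, rfl⟩
      -- Translation by whole periods brings the second coordinate into one period, so a compact
      -- rectangle has the same image.
      set n : ℤ := -⌊x 1 / (2 * Real.pi * h)⌋ with hn
      have hfl : x 1 + n * (2 * Real.pi * h) ∈ Icc 0 (2 * Real.pi * h) := by
        have h1 := Int.floor_le (x 1 / (2 * Real.pi * h))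
        have h2 := (Int.lt_floor_add_one (x 1 / (2 * Real.pi * h))).le
        rw [le_div_iff₀ hp] at h1
        rw [div_le_iff₀ hp] at h2
        rw [hn]
        push_cast
        constructor <;> linarith
      have hm : j (x 0, x 1 + n * (2 * Real.pi * h)) ∈ B :=
        ⟨_, ⟨⟨hx.1, hx.2⟩, hfl⟩, rfl⟩
      refine ⟨_, hm, ?_⟩
      exact ((hΦ.eq_iff x ⟨ha.trans hx.1, hx.2.trans hb⟩ _ (hBs hm)).2 ⟨rfl, n, rfl⟩).symm
    · rintro _ ⟨⟨s, t⟩, ⟨hs, -⟩, rfl⟩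
      exact hs
  rw [himg]
  exact hBc.image_of_continuousOn (hΦ.contMDiffOn.continuousOn.mono hBs)

/-- A geodesic moves in the cylinder with constant axial speed, as long as it does not reach the
boundary. -/
theorem geodesic_in_cylinder [T2Space M] (hΦ : IsEmbeddedCylinder l h Φ) (hh : 0 < h)
    {γ : ℝ → M} (hγ : IsUnitGeodesic γ) (h0 : γ 0 ∈ cylinderInterior l Φ) {t : ℝ}
    (ht : axialCoord l Φ (γ 0) + t * axialSpeed l Φ (γ 0) (velocity γ 0) ∈ Ioo 0 l) :
    γ t ∈ cylinderInterior l Φ ∧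
      axialCoord l Φ (γ t) = axialCoord l Φ (γ 0) + t * axialSpeed l Φ (γ 0) (velocity γ 0) ∧
      axialSpeed l Φ (γ t) (velocity γ t) = axialSpeed l Φ (γ 0) (velocity γ 0) := by
  set x := axialCoord l Φ (γ 0)
  set u := axialSpeed l Φ (γ 0) (velocity γ 0)
  set P : Set ℝ := {s | γ s ∈ cylinderInterior l Φ ∧ axialCoord l Φ (γ s) = x + s * u ∧
    axialSpeed l Φ (γ s) (velocity γ s) = u} with hP
  set J : Set ℝ := {s | x + s * u ∈ Ioo 0 l} with hJ
  have hcont : Continuous γ := hγ.contMDiff.continuous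
  have hd : ∀ s, MDifferentiableAt 𝓘(ℝ, ℝ) (𝓡 2) γ s := fun s ↦
    hγ.contMDiff.contMDiffAt.mdifferentiableAt (by norm_num)
  have hJc : IsPreconnected J := by
    refine Convex.isPreconnected fun a ha b hb p q hp hq hpq ↦ ?_
    have h1 := (convex_Ioo 0 l) ha hb hp hq hpq
    have h2 : p • (x + a * u) + q • (x + b * u) = x + (p • a + q • b) * u := by
      simp only [smul_eq_mul]
      linear_combination x * hpq
    rw [h2] at h1
    exact h1
  -- Connectedness argument on the interval `J`: the good times form a set that is open and
  -- relatively closed in `J`.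
  have hPo : IsOpen P := by
    refine isOpen_iff_mem_nhds.2 fun s hs ↦ ?_
    obtain ⟨r, hr, hball⟩ := Metric.isOpen_iff.1
      (hΦ.isOpen_cylinderInterior.preimage hcont) s hs.1
    have hU : ∀ s' ∈ Metric.ball s r, axialSpeed l Φ (γ s') (velocity γ s') = u := fun s' hs' ↦ by
      rw [← hs.2.2]
      refine Convex.is_const_of_fderivWithin_eq_zero (𝕜 := ℝ) (convex_ball s r)
        (f := fun s ↦ axialSpeed l Φ (γ s) (velocity γ s))
        (fun y hy ↦ (hΦ.hasDerivAt_axialSpeed_velocity hγ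
          (hball hy)).differentiableAt.differentiableWithinAt) (fun y hy ↦ ?_) hs'
        (Metric.mem_ball_self hr)
      rw [fderivWithin_of_isOpen Metric.isOpen_ball hy,
        (hΦ.hasDerivAt_axialSpeed_velocity hγ (hball hy)).hasFDerivAt.fderiv]
      simp
    refine Filter.mem_of_superset (Metric.ball_mem_nhds s hr) fun s' hs' ↦
      ⟨hball hs', ?_, hU s' hs'⟩
    have hder : ∀ y ∈ Metric.ball s r,
        HasDerivAt (fun z ↦ axialCoord l Φ (γ z) - z * u) 0 y := fun y hy ↦ by
      have h1 := (hΦ.hasDerivAt_axialCoord_comp (hd y) (hball hy)).sub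
        ((hasDerivAt_id y).mul_const u)
      rw [hU y hy] at h1
      simpa using! h1
    have h2 := Convex.is_const_of_fderivWithin_eq_zero (𝕜 := ℝ) (convex_ball s r)
        (f := fun z ↦ axialCoord l Φ (γ z) - z * u)
        (fun y hy ↦ (hder y hy).differentiableAt.differentiableWithinAt) (fun y hy ↦ by
          rw [fderivWithin_of_isOpen Metric.isOpen_ball hy, (hder y hy).hasFDerivAt.fderiv]
          simp) hs' (Metric.mem_ball_self hr)
    simp only [hs.2.1] at h2
    linarith
  have hPc : closure P ∩ J ⊆ P := by
    rintro s ⟨hsP, hsJ⟩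
    have hfreq := mem_closure_iff_frequently.1 hsP
    have hmem : γ s ∈ cylinderInterior l Φ := by
      -- Midpoints towards the two ends: at good times near `s` the geodesic lies in the compact
      -- subcylinder over `[a, b]`, so its limit does too and stays off the boundary.
      set a := (x + s * u) / 2 with ha
      set b := (x + s * u + l) / 2 with hb
      have ha0 : 0 < a := by rw [ha]; linarith [hsJ.1]
      have hbl : b < l := by rw [hb]; linarith [hsJ.2]
      have hev : ∀ᶠ s' in 𝓝 s, x + s' * u ∈ Ioo a b := by
        have : Continuous fun s' : ℝ ↦ x + s' * u := by fun_prop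
        refine this.continuousAt.eventually_mem (isOpen_Ioo.mem_nhds ⟨?_, ?_⟩)
        · rw [ha]; linarith [hsJ.1]
        · rw [hb]; linarith [hsJ.2]
      have hK := (hΦ.isCompact_image hh ha0.le hbl.le).isClosed
      have h1 : ∃ᶠ s' in 𝓝 s, γ s' ∈ Φ '' {x | a ≤ x 0 ∧ x 0 ≤ b} := by
        refine (hfreq.and_eventually hev).mono ?_
        rintro s' ⟨⟨⟨y, hy, hys⟩, hX, -⟩, hs'⟩
        refine ⟨y, ?_, hys⟩
        rw [← hX, ← hys, hΦ.axialCoord_apply hy] at hs'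
        exact ⟨hs'.1.le, hs'.2.le⟩
      obtain ⟨y, hy, hys⟩ := hK.mem_of_frequently_of_tendsto h1 hcont.continuousAt
      exact ⟨y, ⟨ha0.trans_le hy.1, hy.2.trans_lt hbl⟩, hys⟩
    have hX := (hΦ.hasDerivAt_axialCoord_comp (hd s) hmem).continuousAt
    have hU := (hΦ.hasDerivAt_axialSpeed_velocity hγ hmem).continuousAt
    refine ⟨hmem, ?_, ?_⟩
    · have h1 : ContinuousAt (fun s' ↦ (axialCoord l Φ ∘ γ) s' - (x + s' * u)) s :=
        hX.sub (by fun_prop)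
      exact sub_eq_zero.1 ((isClosed_singleton (x := (0 : ℝ))).mem_of_frequently_of_tendsto
        (hfreq.mono fun s' hs' ↦ sub_eq_zero.2 hs'.2.1) h1)
    · exact isClosed_singleton.mem_of_frequently_of_tendsto (hfreq.mono fun s' hs' ↦ hs'.2.2) hU
  have h0J : (0 : ℝ) ∈ J := by
    change x + 0 * u ∈ Ioo 0 l
    rw [zero_mul, add_zero]
    exact hΦ.axialCoord_mem h0
  have h0P : (0 : ℝ) ∈ P := ⟨h0, by rw [zero_mul, add_zero], rfl⟩
  exact hJc.subset_of_closure_inter_subset hPo ⟨0, h0J, h0P⟩ hPc ht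

end IsEmbeddedCylinder

end AxialCoordinate

/-! ### The flow on unit vectors over the cylinder. -/

section UnitVectors

variable {M : Type*} [TopologicalSpace M] [ChartedSpace Plane M] [IsManifold (𝓡 2) ∞ M]

omit [IsManifold (𝓡 2) ∞ M] in
lemma velocity_comp_add_const {γ : ℝ → M} (hγ : ContMDiff 𝓘(ℝ, ℝ) (𝓡 2) 2 γ) (t : ℝ) :
    velocity (fun s ↦ γ (s + t)) = fun s ↦ velocity γ (s + t) := by
  funext s
  have h1 : HasMFDerivAt 𝓘(ℝ, ℝ) 𝓘(ℝ, ℝ) (fun s : ℝ ↦ s + t) s (ContinuousLinearMap.id ℝ ℝ) :=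
    ((hasFDerivAt_id s).add_const t).hasMFDerivAt
  exact congrArg (fun L ↦ L (1 : ℝ)) (HasMFDerivAt.comp s
    (hγ.contMDiffAt.mdifferentiableAt (by norm_num)).hasMFDerivAt h1).mfderiv

variable [RiemannianBundle (fun x : M ↦ TangentSpace (𝓡 2) x)]

lemma covDerivAlong_comp_add_const {γ : ℝ → M} (hγ : ContMDiff 𝓘(ℝ, ℝ) (𝓡 2) 2 γ)
    (V : ∀ s, TangentSpace (𝓡 2) (γ s)) (t s : ℝ) :
    covDerivAlong (fun s ↦ γ (s + t)) (fun s ↦ V (s + t)) s = covDerivAlong γ V (s + t) := by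
  unfold covDerivAlong
  refine Finset.sum_congr rfl fun k _ ↦ ?_
  rw [velocity_comp_add_const hγ,
    deriv_comp_add_const (fun s' ↦ coordComp (γ (s + t)) (γ s') (V s') k) t s]

namespace IsUnitGeodesic

lemma comp_add_const {γ : ℝ → M} (hγ : IsUnitGeodesic γ) (t : ℝ) :
    IsUnitGeodesic fun s ↦ γ (s + t) where
  contMDiff := hγ.contMDiff.comp
    (contMDiff_iff_contDiff.2 (by fun_prop : ContDiff ℝ 2 fun s : ℝ ↦ s + t))
  norm_velocity s := by
    rw [velocity_comp_add_const hγ.contMDiff]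
    exact hγ.norm_velocity (s + t)
  geodesic_eq s := by
    rw [velocity_comp_add_const hγ.contMDiff, covDerivAlong_comp_add_const hγ.contMDiff]
    exact hγ.geodesic_eq (s + t)

lemma lift_comp_add_const {γ : ℝ → M} (hγ : IsUnitGeodesic γ) (t s : ℝ) :
    (hγ.comp_add_const t).lift s = hγ.lift (s + t) := by
  unfold lift
  congr 2
  rw [velocity_comp_add_const hγ.contMDiff]

lemma continuous_lift {γ : ℝ → M} (hγ : IsUnitGeodesic γ) : Continuous hγ.lift := by
  refine Continuous.subtype_mk ?_ _
  have h1 : Continuous (tangentMap 𝓘(ℝ, ℝ) (𝓡 2) γ) :=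
    hγ.contMDiff.continuous_tangentMap (by norm_num)
  have h2 : Continuous fun t : ℝ ↦ (⟨t, (1 : ℝ)⟩ : TangentBundle 𝓘(ℝ, ℝ) ℝ) := by
    have h3 := (tangentBundleModelSpaceHomeomorph 𝓘(ℝ, ℝ)).symm.continuous
    exact h3.comp (by fun_prop : Continuous fun t : ℝ ↦ ((t, (1 : ℝ)) : ModelProd ℝ ℝ))
  exact h1.comp h2

end IsUnitGeodesic

/-- There is a complete unit speed geodesic with initial velocity `v`. -/
def HasGeodesic (v : UnitTangentBundle M) : Prop :=
  ∃ (γ : ℝ → M) (hγ : IsUnitGeodesic γ), hγ.lift 0 = v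

lemma HasGeodesic.exists_geodesicFlow_eq {v : UnitTangentBundle M} (hv : HasGeodesic v) :
    ∃ (γ : ℝ → M) (hγ : IsUnitGeodesic γ), hγ.lift 0 = v ∧ ∀ t, geodesicFlow t v = hγ.lift t :=
  ⟨hv.choose, hv.choose_spec.choose, hv.choose_spec.choose_spec, fun _ ↦ dif_pos hv⟩

lemma geodesicFlow_of_not_hasGeodesic {v : UnitTangentBundle M} (hv : ¬ HasGeodesic v) (t : ℝ) :
    geodesicFlow t v = v := dif_neg hv

/-- A shifted geodesic is a geodesic, and vectors without one are fixed by convention. Hence the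
exceptional vectors form a flow-invariant set. -/
lemma hasGeodesic_geodesicFlow_iff {v : UnitTangentBundle M} {t : ℝ} :
    HasGeodesic (geodesicFlow t v) ↔ HasGeodesic v := by
  by_cases hv : HasGeodesic v
  · refine iff_of_true ?_ hv
    obtain ⟨γ, hγ, -, h⟩ := hv.exists_geodesicFlow_eq
    refine ⟨_, hγ.comp_add_const t, ?_⟩
    rw [h, hγ.lift_comp_add_const, zero_add]
  · rw [geodesicFlow_of_not_hasGeodesic hv]

/-- The unit vectors with base point in the interior of the cylinder. -/
def cylVectors (l : ℝ) (Φ : Plane → M) : Set (UnitTangentBundle M) :=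
  {v | v.1.1 ∈ cylinderInterior l Φ}

/-- The axial coordinate of the base point of a unit vector. -/
def vectorCoord (l : ℝ) (Φ : Plane → M) (v : UnitTangentBundle M) : ℝ := axialCoord l Φ v.1.1

/-- The axial component of a unit vector. -/
def vectorSpeed (l : ℝ) (Φ : Plane → M) (v : UnitTangentBundle M) : ℝ := axialSpeed l Φ v.1.1 v.1.2

lemma continuous_basePoint : Continuous fun v : UnitTangentBundle M ↦ v.1.1 :=
  (FiberBundle.continuous_proj Plane (TangentSpace (𝓡 2) : M → Type _)).comp continuous_subtype_val

variable {l h : ℝ} {Φ : Plane → M}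

namespace IsEmbeddedCylinder

lemma isOpen_cylVectors (hΦ : IsEmbeddedCylinder l h Φ) : IsOpen (cylVectors l Φ) :=
  hΦ.isOpen_cylinderInterior.preimage continuous_basePoint

omit [IsManifold (𝓡 2) ∞ M] in
lemma vectorCoord_mem (hΦ : IsEmbeddedCylinder l h Φ) {v : UnitTangentBundle M}
    (hv : v ∈ cylVectors l Φ) : vectorCoord l Φ v ∈ Ioo 0 l := hΦ.axialCoord_mem hv

lemma continuousOn_vectorCoord (hΦ : IsEmbeddedCylinder l h Φ) :
    ContinuousOn (vectorCoord l Φ) (cylVectors l Φ) :=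
  hΦ.contMDiffOn_axialCoord.continuousOn.comp continuous_basePoint.continuousOn fun _ hv ↦ hv

lemma continuousOn_vectorSpeed (hΦ : IsEmbeddedCylinder l h Φ) :
    ContinuousOn (vectorSpeed l Φ) (cylVectors l Φ) := by
  have h1 := hΦ.contMDiffOn_axialCoord.continuousOn_tangentMapWithin (by norm_num)
    hΦ.isOpen_cylinderInterior.uniqueMDiffOn
  have h2 : Continuous fun w : TangentBundle 𝓘(ℝ, ℝ) ℝ ↦ (w.2 : ℝ) :=
    (contMDiff_snd_tangentBundle_modelSpace (n := 0) ℝ 𝓘(ℝ, ℝ)).continuous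
  have h3 : ContinuousOn (fun v : UnitTangentBundle M ↦
      tangentMapWithin (𝓡 2) 𝓘(ℝ, ℝ) (axialCoord l Φ) (cylinderInterior l Φ) v.1)
      (cylVectors l Φ) :=
    h1.comp continuous_subtype_val.continuousOn fun _ hv ↦ hv
  refine (h2.comp_continuousOn h3).congr fun v hv ↦ ?_
  have h4 : mfderivWithin (𝓡 2) 𝓘(ℝ, ℝ) (axialCoord l Φ) (cylinderInterior l Φ) v.1.1 =
      mfderiv (𝓡 2) 𝓘(ℝ, ℝ) (axialCoord l Φ) v.1.1 :=
    mfderivWithin_of_isOpen hΦ.isOpen_cylinderInterior hv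
  exact congrArg (fun L ↦ L v.1.2) h4.symm

lemma isOpen_setOf_vectorSpeed (hΦ : IsEmbeddedCylinder l h Φ) {s : Set ℝ} (hs : IsOpen s) :
    IsOpen {v ∈ cylVectors l Φ | vectorSpeed l Φ v ∈ s} :=
  hΦ.continuousOn_vectorSpeed.isOpen_inter_preimage hΦ.isOpen_cylVectors hs

lemma measurableSet_setOf_vectorSpeed (hΦ : IsEmbeddedCylinder l h Φ) {s : Set ℝ}
    (hs : IsOpen s) : MeasurableSet {v ∈ cylVectors l Φ | vectorSpeed l Φ v ∈ s} :=
  (hΦ.isOpen_setOf_vectorSpeed hs).measurableSet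

lemma exists_vectorSpeed_eq (hΦ : IsEmbeddedCylinder l h Φ) (hl : 0 < l) {u : ℝ} (hu : |u| = 1) :
    ∃ v ∈ cylVectors l Φ, vectorSpeed l Φ v = u := by
  have hx : Φ !₂[l / 2, 0] ∈ cylinderInterior l Φ := ⟨_, by simp [hl], rfl⟩
  obtain ⟨v, hv, hvu⟩ := hΦ.exists_axialSpeed_eq hx hu
  exact ⟨⟨⟨_, v⟩, hv⟩, hx, hvu⟩

/-- A geodesic moves in the cylinder with constant axial speed. -/
lemma lift_mem_cylVectors [T2Space M] (hΦ : IsEmbeddedCylinder l h Φ) (hh : 0 < h)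
    {γ : ℝ → M} (hγ : IsUnitGeodesic γ) {s : ℝ} (hs : hγ.lift s ∈ cylVectors l Φ) (t : ℝ)
    (ht : vectorCoord l Φ (hγ.lift s) + (t - s) * vectorSpeed l Φ (hγ.lift s) ∈ Ioo 0 l) :
    hγ.lift t ∈ cylVectors l Φ ∧
      vectorCoord l Φ (hγ.lift t) =
        vectorCoord l Φ (hγ.lift s) + (t - s) * vectorSpeed l Φ (hγ.lift s) ∧
      vectorSpeed l Φ (hγ.lift t) = vectorSpeed l Φ (hγ.lift s) := by
  have h0 : (hγ.comp_add_const s).lift 0 = hγ.lift s := by rw [hγ.lift_comp_add_const, zero_add]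
  have h1 : (hγ.comp_add_const s).lift (t - s) = hγ.lift t := by
    rw [hγ.lift_comp_add_const, sub_add_cancel]
  rw [← h0] at hs ht ⊢
  rw [← h1]
  exact hΦ.geodesic_in_cylinder hh (hγ.comp_add_const s) hs ht

lemma geodesicFlow_mem_cylVectors [T2Space M] (hΦ : IsEmbeddedCylinder l h Φ) (hh : 0 < h)
    {v : UnitTangentBundle M} (hg : HasGeodesic v) (hv : v ∈ cylVectors l Φ) {t : ℝ}
    (ht : vectorCoord l Φ v + t * vectorSpeed l Φ v ∈ Ioo 0 l) :
    geodesicFlow t v ∈ cylVectors l Φ ∧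
      vectorCoord l Φ (geodesicFlow t v) = vectorCoord l Φ v + t * vectorSpeed l Φ v ∧
      vectorSpeed l Φ (geodesicFlow t v) = vectorSpeed l Φ v := by
  obtain ⟨γ, hγ, rfl, h⟩ := hg.exists_geodesicFlow_eq
  have := hΦ.lift_mem_cylVectors hh hγ hv t
  rw [sub_zero] at this
  rw [h]
  exact this ht

end IsEmbeddedCylinder

end UnitVectors

/-! ### Null sets from ergodicity and full support. -/

section NullSets

variable {M : Type*} [TopologicalSpace M] [T2Space M] [ChartedSpace Plane M]
  [IsManifold (𝓡 2) ∞ M] [RiemannianBundle (fun x : M ↦ TangentSpace (𝓡 2) x)]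
  {l h : ℝ} {Φ : Plane → M} {μ : Measure (UnitTangentBundle M)}

namespace IsEmbeddedCylinder

/-- Almost no vector is tangent to a closed geodesic of the cylinder. -/
theorem measure_setOf_vectorSpeed_eq_zero (hΦ : IsEmbeddedCylinder l h Φ) (hl : 0 < l)
    (hh : 0 < h) [μ.IsOpenPosMeasure] (hμ : IsErgodicInvariant μ) :
    μ {v ∈ cylVectors l Φ | vectorSpeed l Φ v = 0} = 0 := by
  set Z := {v ∈ cylVectors l Φ | vectorSpeed l Φ v = 0} with hZ
  set O := {v ∈ cylVectors l Φ | vectorSpeed l Φ v ∈ ({0}ᶜ : Set ℝ)} with hO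
  have hOo : IsOpen O := hΦ.isOpen_setOf_vectorSpeed isOpen_compl_singleton
  have hZO : Z = cylVectors l Φ \ O := by
    ext v
    simp [hZ, hO]
  have hZm : MeasurableSet Z := by
    rw [hZO]
    exact hΦ.isOpen_cylVectors.measurableSet.diff hOo.measurableSet
  have hinv : ∀ t, geodesicFlow t ⁻¹' Z = Z := fun t ↦ by
    ext v
    by_cases hv : HasGeodesic v
    · obtain ⟨γ, hγ, rfl, hfl⟩ := hv.exists_geodesicFlow_eq
      have key : ∀ s t, hγ.lift s ∈ Z → hγ.lift t ∈ Z := fun s t hs ↦ by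
        have h1 := hΦ.lift_mem_cylVectors hh hγ hs.1 t (by
          rw [hs.2, mul_zero, add_zero]
          exact hΦ.vectorCoord_mem hs.1)
        exact ⟨h1.1, h1.2.2.trans hs.2⟩
      rw [mem_preimage, hfl]
      exact ⟨key t 0, key 0 t⟩
    · rw [mem_preimage, geodesicFlow_of_not_hasGeodesic hv]
  refine (hμ.ergodic Z hZm hinv).resolve_right fun hc ↦ ?_
  obtain ⟨v, hv, hvu⟩ := hΦ.exists_vectorSpeed_eq hl (u := 1) (by simp)
  have hne : O.Nonempty := ⟨v, hv, by simp [hvu]⟩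
  exact (hOo.measure_pos μ hne).ne'
    (measure_mono_null (show O ⊆ Zᶜ from fun w hw hwZ ↦ hw.2 hwZ.2) hc)

/-- Almost every vector that is transversal to the closed geodesics of the cylinder is the
initial velocity of a complete geodesic. -/
theorem measure_setOf_not_hasGeodesic (hΦ : IsEmbeddedCylinder l h Φ) (hl : 0 < l)
    (hh : 0 < h) [μ.IsOpenPosMeasure] (hμ : IsErgodicInvariant μ) :
    μ {v ∈ cylVectors l Φ | vectorSpeed l Φ v ≠ 0 ∧ ¬ HasGeodesic v} = 0 := by
  set C := cylVectors l Φ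
  set X := vectorCoord l Φ
  set U := vectorSpeed l Φ
  have hgm : ∀ t, Measurable (geodesicFlow (M := M) t) := fun t ↦ (hμ.invariant t).measurable
  have hXm : Measurable (C.indicator X) := by
    classical
    have := hΦ.continuousOn_vectorCoord.measurable_piecewise (g := fun _ ↦ (0 : ℝ))
      continuousOn_const hΦ.isOpen_cylVectors.measurableSet
    convert this using 1
    ext v
    by_cases hv : v ∈ C <;> simp [hv, C, X]
  -- Along a geodesic a nonzero axial speed changes the coordinate at every small nonzero time, so
  -- being stationary detects the default value of the flow. Rational times suffice, which makes the
  -- condition measurable.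
  have hchar : ∀ v ∈ C, U v ≠ 0 → (¬ HasGeodesic v ↔
      ∀ q : ℚ, C.indicator X (geodesicFlow q v) = C.indicator X v) := fun v hv hU ↦ by
    refine ⟨fun h q ↦ by rw [geodesicFlow_of_not_hasGeodesic h], fun h hg ↦ ?_⟩
    have hcont : ContinuousAt (fun t : ℝ ↦ X v + t * U v) 0 := by fun_prop
    have hev : ∀ᶠ t : ℝ in 𝓝 0, X v + t * U v ∈ Ioo 0 l :=
      hcont.eventually_mem (isOpen_Ioo.mem_nhds (by simpa using! hΦ.vectorCoord_mem hv))
    obtain ⟨r, hr, hball⟩ := Metric.eventually_nhds_iff.1 hev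
    obtain ⟨q, hq0, hqr⟩ := exists_rat_btwn hr
    have h1 := hΦ.geodesicFlow_mem_cylVectors hh hg hv (t := q)
      (hball (by rw [dist_zero_right, Real.norm_eq_abs, abs_of_pos hq0]; exact hqr))
    have h2 := h q
    rw [indicator_of_mem h1.1, indicator_of_mem hv] at h2
    have h3 : (q : ℝ) * U v = 0 := by linarith [h1.2.1.symm.trans h2]
    exact (mul_ne_zero hq0.ne' hU) h3
  have hNm : MeasurableSet {v | ∀ q : ℚ, C.indicator X (geodesicFlow q v) = C.indicator X v} := by
    simp only [ofPred_forall]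
    exact MeasurableSet.iInter fun q ↦ measurableSet_eq_fun (hXm.comp (hgm q)) hXm
  -- The set is fixed pointwise by the flow, and its complement contains the nonempty open set of
  -- vectors with speed in `s'`. Splitting by the sign of the speed supplies such an `s'`.
  have hzero : ∀ s s' : Set ℝ, IsOpen s → IsOpen s' → Disjoint s s' → 0 ∉ s →
      (∃ u ∈ s', |u| = 1) → μ {v ∈ {v ∈ C | U v ∈ s} | ¬ HasGeodesic v} = 0 := by
    rintro s s' hs hs' hdisj h0 ⟨u, hu, hu1⟩
    have hA : MeasurableSet {v ∈ {v ∈ C | U v ∈ s} | ¬ HasGeodesic v} := by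
      have h1 : {v ∈ {v ∈ C | U v ∈ s} | ¬ HasGeodesic v} = {v ∈ C | U v ∈ s} ∩
          {v | ∀ q : ℚ, C.indicator X (geodesicFlow q v) = C.indicator X v} := by
        ext v
        exact and_congr_right fun hv ↦ hchar v hv.1 fun h ↦ h0 (h ▸ hv.2)
      rw [h1]
      exact (hΦ.measurableSet_setOf_vectorSpeed hs).inter hNm
    refine (hμ.ergodic _ hA fun t ↦ ?_).resolve_right fun hc ↦ ?_
    · ext v
      by_cases hv : HasGeodesic v
      · exact iff_of_false (fun h ↦ h.2 (hasGeodesic_geodesicFlow_iff.2 hv)) fun h ↦ h.2 hv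
      · rw [mem_preimage, geodesicFlow_of_not_hasGeodesic hv]
    · obtain ⟨v, hv, hvu⟩ := hΦ.exists_vectorSpeed_eq hl hu1
      have hO := hΦ.isOpen_setOf_vectorSpeed hs'
      refine (hO.measure_pos μ ⟨v, hv, by rwa [hvu]⟩).ne' (measure_mono_null ?_ hc)
      exact fun w hw hwA ↦ disjoint_left.1 hdisj hwA.1.2 hw.2
  have hpos := hzero (Ioi 0) (Iio 0) isOpen_Ioi isOpen_Iio
    (disjoint_left.2 fun _ h1 h2 ↦ lt_asymm (mem_Ioi.1 h1) h2) (by simp) ⟨-1, by simp⟩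
  have hneg := hzero (Iio 0) (Ioi 0) isOpen_Iio isOpen_Ioi
    (disjoint_left.2 fun _ h1 h2 ↦ lt_asymm (mem_Ioi.1 h2) h1) (by simp) ⟨1, by simp⟩
  refine measure_mono_null (fun v hv ↦ ?_) (measure_union_null hpos hneg)
  rcases lt_or_gt_of_ne hv.2.1 with h1 | h1
  · exact Or.inr ⟨⟨hv.1, h1⟩, hv.2.2⟩
  · exact Or.inl ⟨⟨hv.1, h1⟩, hv.2.2⟩

end IsEmbeddedCylinder

end NullSets

/-! ### The mass of a band. -/

section BandEstimate

lemma volume_setOf_add_mul_mem_Ioo (x a b : ℝ) {u : ℝ} (hu : u ≠ 0) :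
    volume {t : ℝ | x + t * u ∈ Ioo a b} = ENNReal.ofReal |u⁻¹| * ENNReal.ofReal (b - a) := by
  have h1 : {t : ℝ | x + t * u ∈ Ioo a b} = (· * u) ⁻¹' ((x + ·) ⁻¹' Ioo a b) := rfl
  rw [h1, Real.volume_preimage_mul_right hu, measure_preimage_add, Real.volume_Ioo]

lemma measurableSet_setOf_add_mul_mem_Ioo (x a b u : ℝ) :
    MeasurableSet {t : ℝ | x + t * u ∈ Ioo a b} :=
  measurableSet_Ioo.preimage (by fun_prop : Measurable fun t : ℝ ↦ x + t * u)

variable {M : Type*} [TopologicalSpace M] [T2Space M] [ChartedSpace Plane M]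
  [IsManifold (𝓡 2) ∞ M] [RiemannianBundle (fun x : M ↦ TangentSpace (𝓡 2) x)]
  {l h : ℝ} {Φ : Plane → M} {μ : Measure (UnitTangentBundle M)}

/-- An ergodic invariant measure of full support gives mass at most `2ε/l` to the unit vectors
based in a band of width `2ε` of a flat cylinder of width `l`. -/
theorem IsEmbeddedCylinder.measure_band_le (hΦ : IsEmbeddedCylinder l h Φ) (hl : 0 < l)
    (hh : 0 < h) [IsProbabilityMeasure μ] [μ.IsOpenPosMeasure] (hμ : IsErgodicInvariant μ)
    (a ε : ℝ) :
    μ {v ∈ cylVectors l Φ | vectorCoord l Φ v ∈ Ioo (a - ε) (a + ε)} ≤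
      ENNReal.ofReal (2 * ε / l) := by
  classical
  set C := cylVectors l Φ
  have hC : MeasurableSet C := hΦ.isOpen_cylVectors.measurableSet
  set X := C.indicator (vectorCoord l Φ) with hXdef
  set U := C.indicator (vectorSpeed l Φ) with hUdef
  have hXC : ∀ v ∈ C, X v = vectorCoord l Φ v := fun v hv ↦ indicator_of_mem hv _
  have hUC : ∀ v ∈ C, U v = vectorSpeed l Φ v := fun v hv ↦ indicator_of_mem hv _
  have hXm : Measurable X := by
    rw [hXdef, ← piecewise_eq_indicator]
    exact hΦ.continuousOn_vectorCoord.measurable_piecewise continuousOn_const hC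
  have hUm : Measurable U := by
    rw [hUdef, ← piecewise_eq_indicator]
    exact hΦ.continuousOn_vectorSpeed.measurable_piecewise continuousOn_const hC
  set O := {v ∈ C | U v ≠ 0} with hOdef
  have hO : MeasurableSet O := hC.inter (hUm (measurableSet_singleton 0).compl)
  set B := {v ∈ O | X v ∈ Ioo (a - ε) (a + ε)} with hBdef
  have hB : MeasurableSet B := hO.inter (hXm measurableSet_Ioo)
  -- `S` pairs a vector of the band with the times at which it is still in the same crossing of the
  -- cylinder; `S'` describes the pairs from the end point, whose coordinate at time `-t` lies in
  -- the band.
  set S : Set (UnitTangentBundle M × ℝ) := {p | p.1 ∈ B ∧ X p.1 + p.2 * U p.1 ∈ Ioo 0 l} with hS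
  set S' : Set (UnitTangentBundle M × ℝ) :=
    {p | p.1 ∈ O ∧ X p.1 + p.2 * -U p.1 ∈ Ioo (a - ε) (a + ε)} with hS'
  have hSm : MeasurableSet S := (measurable_fst hB).inter
    (((hXm.comp measurable_fst).add (measurable_snd.mul (hUm.comp measurable_fst)))
      measurableSet_Ioo)
  have hSm' : MeasurableSet S' := (measurable_fst hO).inter
    (((hXm.comp measurable_fst).add (measurable_snd.mul (hUm.comp measurable_fst).neg))
      measurableSet_Ioo)
  -- The inverse of the crossing time: a crossing gets total weight `1`, and its times in the band
  -- at most `2ε/l`.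
  set D : UnitTangentBundle M × ℝ → ℝ≥0∞ := fun p ↦ ENNReal.ofReal (|U p.1| / l) with hD
  have hDm : Measurable D :=
    ENNReal.measurable_ofReal.comp ((hUm.comp measurable_fst).abs.div_const l)
  have hweight : ∀ u w : ℝ, u ≠ 0 → ENNReal.ofReal (|u| / l) *
      (ENNReal.ofReal |u⁻¹| * ENNReal.ofReal w) = ENNReal.ofReal (w / l) := fun u w hu ↦ by
    have hu' : |u| ≠ 0 := abs_ne_zero.2 hu
    rw [← mul_assoc, ← ENNReal.ofReal_mul (by positivity), ← ENNReal.ofReal_mul (by positivity),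
      abs_inv]
    congr 1
    field_simp
  have hint : ∀ v, ∫⁻ t, S.indicator D (v, t) = B.indicator 1 v := fun v ↦ by
    by_cases hv : v ∈ B
    · have h1 : (fun t ↦ S.indicator D (v, t)) =
          {t : ℝ | X v + t * U v ∈ Ioo 0 l}.indicator fun _ ↦ ENNReal.ofReal (|U v| / l) := by
        ext t
        simp only [indicator, hS, mem_ofPred_eq, hv, true_and, hD]
      rw [h1, lintegral_indicator_const (measurableSet_setOf_add_mul_mem_Ioo _ _ _ _),
        volume_setOf_add_mul_mem_Ioo _ _ _ hv.1.2, hweight _ _ hv.1.2, indicator_of_mem hv,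
        sub_zero, div_self hl.ne', ENNReal.ofReal_one, Pi.one_apply]
    · rw [indicator_of_notMem hv]
      have h1 : (fun t ↦ S.indicator D (v, t)) = fun _ ↦ 0 := by
        ext t
        exact indicator_of_notMem (fun h ↦ hv h.1) _
      rw [h1, lintegral_zero]
  have hint' : ∀ v, ∫⁻ t, S'.indicator D (v, t) ≤ ENNReal.ofReal (2 * ε / l) := fun v ↦ by
    by_cases hv : v ∈ O
    · have h1 : (fun t ↦ S'.indicator D (v, t)) =
          {t : ℝ | X v + t * -U v ∈ Ioo (a - ε) (a + ε)}.indicator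
            fun _ ↦ ENNReal.ofReal (|U v| / l) := by
        ext t
        simp only [indicator, hS', mem_ofPred_eq, hv, true_and, hD]
      rw [h1, lintegral_indicator_const (measurableSet_setOf_add_mul_mem_Ioo _ _ _ _),
        volume_setOf_add_mul_mem_Ioo _ _ _ (neg_ne_zero.2 hv.2), ← abs_neg,
        hweight _ _ (neg_ne_zero.2 hv.2)]
      refine ENNReal.ofReal_le_ofReal (le_of_eq ?_)
      ring
    · have h1 : (fun t ↦ S'.indicator D (v, t)) = fun _ ↦ 0 := by
        ext t
        exact indicator_of_notMem (fun h ↦ hv h.1) _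
      rw [h1, lintegral_zero]
      exact zero_le
  -- For fixed `t`, `geodesicFlow t` preserves `μ`, sends the slice of `S` into that of `S'` up to a
  -- null set, and preserves the weight because it preserves the axial speed.
  have hmove : ∀ t, ∫⁻ v, S.indicator D (v, t) ∂μ ≤ ∫⁻ v, S'.indicator D (v, t) ∂μ := fun t ↦ by
    have hm : Measurable fun v ↦ S'.indicator D (v, t) :=
      (hDm.indicator hSm').comp (measurable_id.prodMk measurable_const)
    rw [← (hμ.invariant t).lintegral_comp hm]
    refine lintegral_mono_ae ?_
    have hae := measure_eq_zero_iff_ae_notMem.1 (hΦ.measure_setOf_not_hasGeodesic hl hh hμ)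
    filter_upwards [hae] with v hv
    by_cases hvS : (v, t) ∈ S
    · have hvC : v ∈ C := hvS.1.1.1
      have hg : HasGeodesic v := by
        by_contra hng
        exact hv ⟨hvC, by rw [← hUC v hvC]; exact hvS.1.1.2, hng⟩
      have h2 := hΦ.geodesicFlow_mem_cylVectors hh hg hvC (t := t)
        (by rw [← hXC v hvC, ← hUC v hvC]; exact hvS.2)
      rw [← hXC v hvC, ← hUC v hvC, ← hXC _ h2.1, ← hUC _ h2.1] at h2
      have h3 : (geodesicFlow t v, t) ∈ S' := by
        refine ⟨⟨h2.1, ?_⟩, ?_⟩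
        · rw [h2.2.2]
          exact hvS.1.1.2
        · simp only [h2.2.1, h2.2.2]
          rw [mul_neg, add_neg_cancel_right]
          exact hvS.1.2
      rw [indicator_of_mem hvS, indicator_of_mem h3]
      simp only [hD, h2.2.2]
      exact le_rfl
    · rw [indicator_of_notMem hvS]
      exact zero_le
  have hBle : μ B ≤ ENNReal.ofReal (2 * ε / l) := calc
    μ B = ∫⁻ v, B.indicator 1 v ∂μ := (lintegral_indicator_one hB).symm
    _ = ∫⁻ v, (∫⁻ t, S.indicator D (v, t)) ∂μ := by simp only [hint]
    _ = ∫⁻ t, ∫⁻ v, S.indicator D (v, t) ∂μ :=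
      lintegral_lintegral_swap (f := fun v t ↦ S.indicator D (v, t))
        (hDm.indicator hSm).aemeasurable
    _ ≤ ∫⁻ t, ∫⁻ v, S'.indicator D (v, t) ∂μ := lintegral_mono hmove
    _ = ∫⁻ v, (∫⁻ t, S'.indicator D (v, t)) ∂μ :=
      (lintegral_lintegral_swap (f := fun v t ↦ S'.indicator D (v, t))
        (hDm.indicator hSm').aemeasurable).symm
    _ ≤ ∫⁻ _, ENNReal.ofReal (2 * ε / l) ∂μ := lintegral_mono hint'
    _ = ENNReal.ofReal (2 * ε / l) := by simp
  calc μ {v ∈ C | vectorCoord l Φ v ∈ Ioo (a - ε) (a + ε)}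
      ≤ μ (B ∪ {v ∈ C | vectorSpeed l Φ v = 0}) := measure_mono fun v hv ↦ by
        by_cases h0 : vectorSpeed l Φ v = 0
        · exact Or.inr ⟨hv.1, h0⟩
        · exact Or.inl ⟨⟨hv.1, by rwa [hUC v hv.1]⟩, by rw [hXC v hv.1]; exact hv.2⟩
    _ ≤ μ B + μ {v ∈ C | vectorSpeed l Φ v = 0} := measure_union_le _ _
    _ ≤ ENNReal.ofReal (2 * ε / l) := by
        rw [hΦ.measure_setOf_vectorSpeed_eq_zero hl hh hμ, add_zero]
        exact hBle

end BandEstimate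

/-! ### Short paths stay in the cylinder. -/

section Paths

variable {M : Type*} [TopologicalSpace M] [T2Space M] [ChartedSpace Plane M]
  [IsManifold (𝓡 2) ∞ M] [RiemannianBundle (fun x : M ↦ TangentSpace (𝓡 2) x)]
  {l h : ℝ} {Φ : Plane → M}

/-- A path that starts in the interior of the cylinder and is shorter than the distance to the
boundary remains in the interior, and its axial displacement is at most its length. -/
theorem IsEmbeddedCylinder.path_in_cylinder (hΦ : IsEmbeddedCylinder l h Φ) (hh : 0 < h)
    {p : ℝ → M} (hp : ContMDiff 𝓘(ℝ, ℝ) (𝓡 2) 1 p) (h0 : p 0 ∈ cylinderInterior l Φ)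
    (hlen : ∀ y ∈ cylinderBoundary l Φ, pathELength (𝓡 2) p 0 1 < riemannianEDist (𝓡 2) (p 0) y) :
    p 1 ∈ cylinderInterior l Φ ∧
      ‖axialCoord l Φ (p 1) - axialCoord l Φ (p 0)‖ₑ ≤ pathELength (𝓡 2) p 0 1 := by
  have hin : Icc (0 : ℝ) 1 ⊆ p ⁻¹' cylinderInterior l Φ := by
    refine isPreconnected_Icc.subset_of_closure_inter_subset
      (hΦ.isOpen_cylinderInterior.preimage hp.continuous) ⟨0, by simp, h0⟩ ?_
    rintro t ⟨htc, ht⟩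
    -- A limit of interior points outside the interior is on the boundary; the path up to that time
    -- would then be at least as long as the distance to the boundary.
    by_contra htn
    have h1 : p t ∈ Φ '' {x | 0 ≤ x 0 ∧ x 0 ≤ l} := by
      have h2 : p t ∈ closure (cylinderInterior l Φ) :=
        closure_mono (image_preimage_subset p _)
          (image_closure_subset_closure_image hp.continuous (mem_image_of_mem p htc))
      have h3 : {x : Plane | 0 < x 0 ∧ x 0 < l} ⊆ {x | 0 ≤ x 0 ∧ x 0 ≤ l} :=
        fun x hx ↦ ⟨hx.1.le, hx.2.le⟩
      exact closure_minimal (image_mono h3)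
        (hΦ.isCompact_image hh le_rfl le_rfl).isClosed h2
    obtain ⟨x, hx, hxt⟩ := h1
    have h3 : p t ∈ cylinderBoundary l Φ := by
      refine ⟨x, ?_, hxt⟩
      by_contra hxn
      simp only [mem_ofPred_eq, not_or] at hxn
      exact htn ⟨x, ⟨lt_of_le_of_ne hx.1 (Ne.symm hxn.1), lt_of_le_of_ne hx.2 hxn.2⟩, hxt⟩
    have h4 := riemannianEDist_le_pathELength (I := 𝓡 2) (hp.contMDiffOn (s := Icc 0 t)) rfl rfl ht.1
    exact absurd ((hlen _ h3).trans_le h4) (not_lt.2 (pathELength_mono le_rfl ht.2))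
  refine ⟨hin (by simp), ?_⟩
  have hcd : ContDiffOn ℝ 1 (axialCoord l Φ ∘ p) (Icc 0 1) := by
    rw [← contMDiffOn_iff_contDiffOn]
    exact (hΦ.contMDiffOn_axialCoord.of_le (by norm_num)).comp hp.contMDiffOn hin
  refine (enorm_sub_le_lintegral_deriv_of_contDiffOn_Icc hcd zero_le_one).trans ?_
  rw [pathELength_eq_lintegral_mfderiv_Icc]
  refine setLIntegral_mono' measurableSet_Icc fun t ht ↦ ?_
  rw [(hΦ.hasDerivAt_axialCoord_comp (hp.contMDiffAt.mdifferentiableAt (by norm_num))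
    (hin ht)).deriv]
  rw [← ofReal_norm, ← ofReal_norm]
  exact ENNReal.ofReal_le_ofReal (hΦ.abs_axialSpeed_le (hin ht) _)

omit [T2Space M] in
-- Dropping the vertical term `‖DV/dt‖²` can only shorten a curve.
lemma pathELength_le_sasakiLength (c : ℝ → TangentBundle (𝓡 2) M) :
    pathELength (𝓡 2) (fun s ↦ (c s).1) 0 1 ≤ sasakiLength c := by
  rw [pathELength_eq_lintegral_mfderiv_Icc]
  refine lintegral_mono fun t ↦ ?_
  rw [← ofReal_norm]
  refine ENNReal.ofReal_le_ofReal (Real.le_sqrt_of_sq_le ?_)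
  exact le_add_of_nonneg_right (sq_nonneg _)

/-- Neighbourhoods, for the Sasaki distance, of vectors based at points of the cylinder. -/
theorem IsEmbeddedCylinder.mem_band_of_sasakiEDist_lt (hΦ : IsEmbeddedCylinder l h Φ) (hh : 0 < h)
    {v w : UnitTangentBundle M} {ε : ℝ} (hv : v ∈ cylVectors l Φ)
    (hd : ∀ y ∈ cylinderBoundary l Φ, ENNReal.ofReal ε ≤ riemannianEDist (𝓡 2) v.1.1 y)
    (hvw : sasakiEDist v w < ENNReal.ofReal ε) :
    w ∈ cylVectors l Φ ∧
      vectorCoord l Φ w ∈ Ioo (vectorCoord l Φ v - ε) (vectorCoord l Φ v + ε) := by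
  simp only [sasakiEDist, iInf_lt_iff] at hvw
  obtain ⟨c, hc, rfl, rfl, hlen⟩ := hvw
  have hp : ContMDiff 𝓘(ℝ, ℝ) (𝓡 2) 1 fun s ↦ (c s).1.1 :=
    (contMDiff_proj (TangentSpace (𝓡 2) : M → Type _)).comp hc
  have hl := (pathELength_le_sasakiLength fun s ↦ (c s).1).trans_lt hlen
  obtain ⟨h1, h2⟩ := hΦ.path_in_cylinder hh hp hv fun y hy ↦ hl.trans_le (hd y hy)
  refine ⟨h1, ?_⟩
  have h3 := h2.trans_lt hl
  rw [← ofReal_norm, ENNReal.ofReal_lt_ofReal_iff_of_nonneg (norm_nonneg _),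
    Real.norm_eq_abs, abs_sub_lt_iff] at h3
  change axialCoord l Φ (c 1).1.1 ∈ Ioo (axialCoord l Φ (c 0).1.1 - ε) (axialCoord l Φ (c 0).1.1 + ε)
  constructor <;> linarith [h3.1, h3.2]

end Paths

/-! ### Closed geodesics and their Dirac measures. -/

section ClosedGeodesics

variable {M : Type*} [TopologicalSpace M] [T2Space M] [ChartedSpace Plane M]
  [IsManifold (𝓡 2) ∞ M] [RiemannianBundle (fun x : M ↦ TangentSpace (𝓡 2) x)]
  {l h : ℝ} {Φ : Plane → M}

omit [T2Space M] in
/-- The closed geodesics of a flat cylinder have constant axial coordinate. -/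
lemma IsEmbeddedCylinder.axialCoord_closed_geodesic (hΦ : IsEmbeddedCylinder l h Φ) {γ : ℝ → M}
    (hγ : IsUnitGeodesic γ) {T : ℝ} (hT : 0 < T) (hper : Function.Periodic γ T)
    (hγΦ : range γ ⊆ cylinderInterior l Φ) (t : ℝ) :
    axialCoord l Φ (γ t) = axialCoord l Φ (γ 0) := by
  have hin : ∀ s, γ s ∈ cylinderInterior l Φ := fun s ↦ hγΦ ⟨s, rfl⟩
  have hU : ∀ s, axialSpeed l Φ (γ s) (velocity γ s) = axialSpeed l Φ (γ 0) (velocity γ 0) :=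
    fun s ↦ is_const_of_deriv_eq_zero
      (fun s ↦ (hΦ.hasDerivAt_axialSpeed_velocity hγ (hin s)).differentiableAt)
      (fun s ↦ (hΦ.hasDerivAt_axialSpeed_velocity hγ (hin s)).deriv) s 0
  set u := axialSpeed l Φ (γ 0) (velocity γ 0)
  have hder : ∀ s, HasDerivAt (fun z ↦ axialCoord l Φ (γ z) - z * u) 0 s := fun s ↦ by
    have h1 := (hΦ.hasDerivAt_axialCoord_comp
      (hγ.contMDiff.contMDiffAt.mdifferentiableAt (by norm_num)) (hin s)).sub
        ((hasDerivAt_id s).mul_const u)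
    rw [hU s] at h1
    simpa using! h1
  have hX : ∀ s, axialCoord l Φ (γ s) - s * u = axialCoord l Φ (γ 0) - 0 * u := fun s ↦
    is_const_of_deriv_eq_zero (fun s ↦ (hder s).differentiableAt) (fun s ↦ (hder s).deriv) s 0
  -- After one period the axial coordinate has grown by `T * u`, yet returns to its value.
  have hu : u = 0 := by
    have h1 := hX T
    rw [hper.eq] at h1
    have h2 : T * u = 0 := by linarith
    exact (mul_eq_zero.1 h2).resolve_left hT.ne'
  have h1 := hX t
  rw [hu] at h1
  linarith

omit [T2Space M] in
lemma isProbabilityMeasure_closedGeodesicMeasure {γ : ℝ → M} (hγ : IsUnitGeodesic γ) {T : ℝ}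
    (hT : 0 < T) : IsProbabilityMeasure (closedGeodesicMeasure hγ T) := by
  refine ⟨?_⟩
  rw [closedGeodesicMeasure, Measure.smul_apply,
    Measure.map_apply hγ.continuous_lift.measurable MeasurableSet.univ, preimage_univ,
    Measure.restrict_apply_univ, Real.volume_Ioc, sub_zero, smul_eq_mul]
  exact ENNReal.inv_mul_cancel (by simpa using hT) ENNReal.ofReal_ne_top

/-- The measure carried by a closed geodesic gives full mass to the vectors based on it. -/
lemma closedGeodesicMeasure_setOf_mem_range {γ : ℝ → M} (hγ : IsUnitGeodesic γ) {T : ℝ}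
    (hT : 0 < T) (hper : Function.Periodic γ T) :
    MeasurableSet {v : UnitTangentBundle M | v.1.1 ∈ range γ} ∧
      closedGeodesicMeasure hγ T {v | v.1.1 ∈ range γ} = 1 := by
  have hcl : IsClosed (range γ) := by
    rw [← hper.image_Icc hT 0]
    exact (isCompact_Icc.image hγ.contMDiff.continuous).isClosed
  have hm : MeasurableSet {v : UnitTangentBundle M | v.1.1 ∈ range γ} :=
    (hcl.preimage continuous_basePoint).measurableSet
  refine ⟨hm, ?_⟩
  have := isProbabilityMeasure_closedGeodesicMeasure hγ hT
  rw [← measure_univ (μ := closedGeodesicMeasure hγ T)]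
  rw [closedGeodesicMeasure, Measure.smul_apply, Measure.smul_apply,
    Measure.map_apply hγ.continuous_lift.measurable MeasurableSet.univ,
    Measure.map_apply hγ.continuous_lift.measurable hm]
  congr 2
  exact eq_univ_of_forall fun t ↦ ⟨t, rfl⟩

end ClosedGeodesics

end

/-! ### The lower bound for the Prohorov distance. -/

theorem theorem8 {M : Type*} [TopologicalSpace M] [T2Space M] [CompactSpace M]
    [ChartedSpace Plane M] [IsManifold (𝓡 2) ∞ M]
    [RiemannianBundle (fun x : M ↦ TangentSpace (𝓡 2) x)]
    [IsContMDiffRiemannianBundle (𝓡 2) ∞ Plane (fun x : M ↦ TangentSpace (𝓡 2) x)]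
    (l h : ℝ) (hl : 0 < l) (hh : 0 < h)
    (Φ : Plane → M) (hΦ : IsEmbeddedCylinder l h Φ)
    (μ : Measure (UnitTangentBundle M)) [IsProbabilityMeasure μ] [μ.IsOpenPosMeasure]
    (hμ : IsErgodicInvariant μ)
    (γ : ℝ → M) (hγ : IsUnitGeodesic γ) (T : ℝ) (hT : 0 < T) (hper : Function.Periodic γ T)
    (hγΦ : range γ ⊆ cylinderInterior l Φ) :
    min (riemannianSetDist (range γ) (cylinderBoundary l Φ)) (ENNReal.ofReal (l / (l + 2))) ≤
      ENNReal.ofReal (prohorovDist (closedGeodesicMeasure hγ T) μ) := by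
  have hprob := isProbabilityMeasure_closedGeodesicMeasure hγ hT
  set m := min (riemannianSetDist (range γ) (cylinderBoundary l Φ))
    (ENNReal.ofReal (l / (l + 2))) with hm
  have hmtop : m ≠ ⊤ := ne_top_of_le_ne_top ENNReal.ofReal_ne_top (min_le_right _ _)
  rw [← ENNReal.ofReal_toReal hmtop]
  -- The value `1` is always admissible for probability measures, so the real infimum is over a
  -- nonempty set and bounding each admissible `ε` is enough.
  refine ENNReal.ofReal_le_ofReal (le_csInf ⟨1, one_pos, fun A _ ↦ ?_⟩ ?_)
  · rw [ENNReal.ofReal_one]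
    exact prob_le_one.trans le_add_self
  rintro ε ⟨hε, hA⟩
  by_contra! hlt
  replace hlt : ENNReal.ofReal ε < m := (ENNReal.ofReal_lt_iff_lt_toReal hε.le hmtop).2 hlt
  have hεl : ε < l / (l + 2) :=
    (ENNReal.ofReal_lt_ofReal_iff (by positivity)).1 (hlt.trans_le (min_le_right _ _))
  obtain ⟨hAm, hA1⟩ := closedGeodesicMeasure_setOf_mem_range hγ hT hper
  have h1 := hA _ hAm
  rw [hA1] at h1
  have hband : sasakiNhd ε {v : UnitTangentBundle M | v.1.1 ∈ range γ} ⊆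
      {v ∈ cylVectors l Φ | vectorCoord l Φ v ∈
        Ioo (axialCoord l Φ (γ 0) - ε) (axialCoord l Φ (γ 0) + ε)} := by
    rintro w ⟨v, hv, hvw⟩
    have hX : vectorCoord l Φ v = axialCoord l Φ (γ 0) := by
      obtain ⟨t, ht⟩ := hv
      rw [vectorCoord, ← ht]
      exact hΦ.axialCoord_closed_geodesic hγ hT hper hγΦ t
    rw [← hX]
    refine hΦ.mem_band_of_sasakiEDist_lt hh (hγΦ hv) (fun y hy ↦ ?_) hvw
    refine (hlt.trans_le (min_le_left _ _)).le.trans ?_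
    exact (iInf₂_le v.1.1 hv).trans (iInf₂_le y hy)
  have h2 := h1.trans (add_le_add_left ((measure_mono hband).trans
    (hΦ.measure_band_le hl hh hμ _ ε)) _)
  rw [← ENNReal.ofReal_add (by positivity) hε.le, ← ENNReal.ofReal_one,
    ENNReal.ofReal_le_ofReal_iff (by positivity)] at h2
  rw [lt_div_iff₀ (by positivity)] at hεl
  -- The threshold `l / (l + 2)` is the solution of `2ε/l + ε = 1`.
  have h3 : 2 * ε / l + ε = ε * (l + 2) / l := by field_simp; ring
  rw [h3, le_div_iff₀ hl] at h2
  linarith
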